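/- Fix the two variables $x, y$, a countably infinite supply of unary predicate symbols, and four binary symbols $E_1, E_2, F_1, F_2$. Let $\mathcal{L}$ be the constant-free, equality-free, monadic fragment of two-variable first-order logic $\mathrm{FO}^2$ extended with $E_1, E_2, F_1, F_2$: its formulas are built from the atoms $P(u)$ (with $P$ a unary predicate symbol) and $E_1(u,v)$, $E_2(u,v)$, $F_1(u,v)$, $F_2(u,v)$, where $u, v \in \{x, y\}$, by the Boolean connectives and the quantifiers $\forall x, \forall y, \exists x, \exists y$; there are no constant symbols, there is no equality, and there are no further relation symbols. The formulas of $\mathcal{L}$ are interpreted in structures with a nonempty domain in which $E_1, E_2, F_1, F_2$ are equivalence relations such that $E_2$ is coarser than $E_1$ (that is, $E_1 \subseteq E_2$) and $F_2$ is coarser than $F_1$ (that is, $F_1 \subseteq F_2$). Then both of the following problems are undecidable: 1. (satisfiability) given a sentence of $\mathcal{L}$, decide whether it has a model of this kind; 2. (finite satisfiability) given a sentence of $\mathcal{L}$, decide whether it has a model of this kind with a finite domain. -/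

import Mathlib

namespace NestedEqFO2

/-- The two variables of the logic: `0` is `x` and `1` is `y`. -/
abbrev Var := Fin 2

/-- The four special binary symbols. -/
inductive EqSym : Type
  | E1 : EqSym
  | E2 : EqSym
  | F1 : EqSym
  | F2 : EqSym

/-- Formulas of the constant-free, equality-free, monadic fragment of two-variable first-order
logic with the special symbols `E1`, `E2`, `F1`, `F2`. The supply of unary predicate symbols is
countably infinite (indexed by `ℕ`); each formula uses finitely many of them. -/
inductive Formula : Type
  | rel : EqSym → Var → Var → Formula
  | pred : ℕ → Var → Formula
  | neg : Formula → Formula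
  | and : Formula → Formula → Formula
  | or : Formula → Formula → Formula
  | imp : Formula → Formula → Formula
  | iff : Formula → Formula → Formula
  | all : Var → Formula → Formula
  | ex : Var → Formula → Formula

namespace EqSym

def toNat : EqSym → ℕ
  | E1 => 0
  | E2 => 1
  | F1 => 2
  | F2 => 3

def ofNat : ℕ → EqSym
  | 0 => E1
  | 1 => E2
  | 2 => F1
  | _ => F2

theorem ofNat_toNat (r : EqSym) : ofNat r.toNat = r := by
  cases r <;> rfl

theorem toNat_lt (r : EqSym) : r.toNat < 4 := by
  cases r <;> decide

theorem toNat_ofNat {n : ℕ} (h : n < 4) : (ofNat n).toNat = n := by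
  interval_cases n <;> rfl

end EqSym

namespace Formula

/-- The variables that occur free in a formula. -/
def freeVars : Formula → Finset Var
  | rel _ u v => {u, v}
  | pred _ v => {v}
  | neg φ => φ.freeVars
  | and φ ψ => φ.freeVars ∪ ψ.freeVars
  | or φ ψ => φ.freeVars ∪ ψ.freeVars
  | imp φ ψ => φ.freeVars ∪ ψ.freeVars
  | iff φ ψ => φ.freeVars ∪ ψ.freeVars
  | all v φ => φ.freeVars.erase v
  | ex v φ => φ.freeVars.erase v

/-- A sentence is a formula without free variables. -/
def IsSentence (φ : Formula) : Prop := φ.freeVars = ∅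

/-- The Gödel number of a formula. -/
def toNat : Formula → ℕ
  | rel r u v => 4 * r.toNat + 2 * u.val + v.val
  | pred p v => 16 + (11 * p + v.val)
  | neg φ => 16 + (11 * φ.toNat + 2)
  | and φ ψ => 16 + (11 * Nat.pair φ.toNat ψ.toNat + 3)
  | or φ ψ => 16 + (11 * Nat.pair φ.toNat ψ.toNat + 4)
  | imp φ ψ => 16 + (11 * Nat.pair φ.toNat ψ.toNat + 5)
  | iff φ ψ => 16 + (11 * Nat.pair φ.toNat ψ.toNat + 6)
  | all v φ => 16 + (11 * φ.toNat + (7 + v.val))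
  | ex v φ => 16 + (11 * φ.toNat + (9 + v.val))

/-- The formula with a given Gödel number. -/
def ofNat (n : ℕ) : Formula :=
  if hn : n < 16 then
    rel (EqSym.ofNat (n / 4)) (Fin.ofNat 2 (n / 2)) (Fin.ofNat 2 n)
  else
    let k := (n - 16) / 11
    have hk : k < n := by omega
    have h1 : k.unpair.1 < n := lt_of_le_of_lt (Nat.unpair_left_le k) hk
    have h2 : k.unpair.2 < n := lt_of_le_of_lt (Nat.unpair_right_le k) hk
    match (n - 16) % 11 with
    | 0 => pred k 0
    | 1 => pred k 1
    | 2 => neg (ofNat k)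
    | 3 => and (ofNat k.unpair.1) (ofNat k.unpair.2)
    | 4 => or (ofNat k.unpair.1) (ofNat k.unpair.2)
    | 5 => imp (ofNat k.unpair.1) (ofNat k.unpair.2)
    | 6 => iff (ofNat k.unpair.1) (ofNat k.unpair.2)
    | 7 => all 0 (ofNat k)
    | 8 => all 1 (ofNat k)
    | 9 => ex 0 (ofNat k)
    | _ => ex 1 (ofNat k)
termination_by n

theorem ofNat_step (k t : ℕ) (ht : t < 11) : ofNat (16 + (11 * k + t)) =
    match t with
    | 0 => pred k 0
    | 1 => pred k 1
    | 2 => neg (ofNat k)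
    | 3 => and (ofNat k.unpair.1) (ofNat k.unpair.2)
    | 4 => or (ofNat k.unpair.1) (ofNat k.unpair.2)
    | 5 => imp (ofNat k.unpair.1) (ofNat k.unpair.2)
    | 6 => iff (ofNat k.unpair.1) (ofNat k.unpair.2)
    | 7 => all 0 (ofNat k)
    | 8 => all 1 (ofNat k)
    | 9 => ex 0 (ofNat k)
    | _ => ex 1 (ofNat k) := by
  rw [ofNat]
  have e1 : (16 + (11 * k + t) - 16) / 11 = k := by omega
  have e2 : (16 + (11 * k + t) - 16) % 11 = t := by omega
  have e3 : ¬ 16 + (11 * k + t) < 16 := by omega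
  simp only [e3, dite_false, e1, e2]
  interval_cases t <;> rfl

theorem ofNat_toNat (φ : Formula) : ofNat φ.toNat = φ := by
  induction φ with
  | rel r u v =>
    cases r <;> fin_cases u <;> fin_cases v <;> simp [toNat, EqSym.toNat, ofNat, EqSym.ofNat]
  | pred p v =>
    fin_cases v
    · exact ofNat_step p 0 (by decide)
    · exact ofNat_step p 1 (by decide)
  | neg φ ih => simp [toNat, ofNat_step, ih]
  | and φ ψ ih1 ih2 => simp [toNat, ofNat_step, ih1, ih2]
  | or φ ψ ih1 ih2 => simp [toNat, ofNat_step, ih1, ih2]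
  | imp φ ψ ih1 ih2 => simp [toNat, ofNat_step, ih1, ih2]
  | iff φ ψ ih1 ih2 => simp [toNat, ofNat_step, ih1, ih2]
  | all v φ ih => fin_cases v <;> simp [toNat, ofNat_step, ih]
  | ex v φ ih => fin_cases v <;> simp [toNat, ofNat_step, ih]

theorem toNat_ofNat (n : ℕ) : (ofNat n).toNat = n := by
  induction n using Nat.strong_induction_on with
  | _ n ih =>
    by_cases hn : n < 16
    · rw [ofNat, dif_pos hn]
      have h4 : n / 4 < 4 := by omega
      simp only [toNat, EqSym.toNat_ofNat h4, Fin.val_ofNat]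
      omega
    · obtain ⟨k, t, ht, rfl⟩ : ∃ k t, t < 11 ∧ n = 16 + (11 * k + t) :=
        ⟨(n - 16) / 11, (n - 16) % 11, by omega, by omega⟩
      have hk := ih k (by omega)
      have h1 := ih k.unpair.1 (lt_of_le_of_lt (Nat.unpair_left_le k) (by omega))
      have h2 := ih k.unpair.2 (lt_of_le_of_lt (Nat.unpair_right_le k) (by omega))
      rw [ofNat_step k t ht]
      interval_cases t <;> simp [toNat, hk, h1, h2]

/-- The Gödel numbering as a bijection with `ℕ`. Through it, Mathlib's notion of a computable
function applies to functions on formulas. -/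
instance : Denumerable Formula :=
  Denumerable.mk' ⟨toNat, ofNat, ofNat_toNat, toNat_ofNat⟩

end Formula

/-- A structure with domain `A`: unary predicates and four equivalence relations such that
`E2` is coarser than `E1` and `F2` is coarser than `F1`. -/
structure Str (A : Type) where
  pred : ℕ → A → Prop
  E1 : Setoid A
  E2 : Setoid A
  F1 : Setoid A
  F2 : Setoid A
  E1_sub_E2 : ∀ a b : A, E1.r a b → E2.r a b
  F1_sub_F2 : ∀ a b : A, F1.r a b → F2.r a b

namespace Str

variable {A : Type}

/-- The interpretation of a special symbol. -/
def interp (𝔄 : Str A) : EqSym → A → A → Prop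
  | EqSym.E1 => 𝔄.E1.r
  | EqSym.E2 => 𝔄.E2.r
  | EqSym.F1 => 𝔄.F1.r
  | EqSym.F2 => 𝔄.F2.r

/-- Truth of a formula in a structure under an assignment of the two variables. -/
def Holds (𝔄 : Str A) : Formula → (Var → A) → Prop
  | Formula.rel r u v, s => 𝔄.interp r (s u) (s v)
  | Formula.pred p v, s => 𝔄.pred p (s v)
  | Formula.neg φ, s => ¬ 𝔄.Holds φ s
  | Formula.and φ ψ, s => 𝔄.Holds φ s ∧ 𝔄.Holds ψ s
  | Formula.or φ ψ, s => 𝔄.Holds φ s ∨ 𝔄.Holds ψ s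
  | Formula.imp φ ψ, s => 𝔄.Holds φ s → 𝔄.Holds ψ s
  | Formula.iff φ ψ, s => 𝔄.Holds φ s ↔ 𝔄.Holds ψ s
  | Formula.all v φ, s => ∀ a : A, 𝔄.Holds φ (Function.update s v a)
  | Formula.ex v φ, s => ∃ a : A, 𝔄.Holds φ (Function.update s v a)

/-- The structure is a model of the formula (for a sentence the assignment is irrelevant). -/
def IsModel (𝔄 : Str A) (φ : Formula) : Prop := ∀ s : Var → A, 𝔄.Holds φ s

end Str

/-- `φ` has a model (with a nonempty domain, finite or infinite). -/
def Satisfiable (φ : Formula) : Prop :=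
  ∃ (A : Type) (_ : Nonempty A) (𝔄 : Str A), 𝔄.IsModel φ

/-- `φ` has a model with a finite nonempty domain. -/
def FinitelySatisfiable (φ : Formula) : Prop :=
  ∃ (A : Type) (_ : Nonempty A) (_ : Finite A) (𝔄 : Str A), 𝔄.IsModel φ

/-- The decision problem "given a sentence, does it have the property `P`?" is decidable: a
computable Boolean function answers it correctly on every sentence. -/
def DecidableOnSentences (P : Formula → Prop) : Prop :=
  ∃ f : Formula → Bool, Computable f ∧ ∀ φ : Formula, φ.IsSentence → (f φ = true ↔ P φ)

end NestedEqFO2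

/-! The halting problem is reduced to both problems through an intermediate counting machine. Its
configurations are pairs `(q, n)` with `n ∈ ℕ³`, and a step to `(q', n')` demands the linear
equations `n * out q = n' * inn q'`.

Such equations can be expressed without equality. An `E2`-class is a configuration; its `E1`-classes
are vertices of three kinds, `n i` of them of kind `i`. A vertex of kind `i` in state `q` carries
outgoing points of colours `(i, j, l)` with `l < out q i j`, and incoming points likewise for `inn
q`. For points of one polarity and colour, `E1` and `F1` agree, and points of one polarity but
different colours are never `F1`-related. Hence the `F1`-classes of outgoing points with target `j`
number `∑ i, out q i j * n i`. An `F2`-class joins the outgoing points of a configuration to the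
incoming points of the next one, and every point is `F1`-related to one of opposite polarity with
the same target. Counting `F1`-classes on both sides gives the equations (`exists_represents`).
Conversely, equal counts give a bijection between the two sets of edges, and from these bijections a
model is built out of any run (`models_canonicalModel`).

A Turing machine configuration becomes the vector `(1, left, right)`, the half tapes read as numbers
in a fixed base, with the scanned symbol kept in the state. A move appends a digit to one number by
the outgoing matrix and removes one from the other by the incoming matrix. The removed digit is
guessed in the new state, but division with remainder makes the guess unique (`step_unique`), so a
model must follow the actual computation.

If the machine runs forever, a model contains an infinite sequence of configurations. They lie in
distinct `E2`-classes, because predecessors are unique and the start has none, so no model is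
finite; if it halts, the canonical model is finite. This settles finite satisfiability. Forbidding
final states gives a sentence that is satisfiable exactly when the machine runs forever. -/

namespace NestedEqFO2

/-! ### Derived connectives and primitive recursive operations on formulas. -/

namespace Formula

/-- Universal closure with respect to both variables. -/
def allxy (φ : Formula) : Formula := all 0 (all 1 φ)

/-- Existential closure with respect to both variables. -/
def exxy (φ : Formula) : Formula := ex 0 (ex 1 φ)

def top : Formula := allxy (imp (pred 0 0) (pred 0 0))

/-- The conjunction of a list of formulas. -/
def conj (l : List Formula) : Formula := l.foldr and top

/-- The disjunction of a list of formulas. -/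
def disj (l : List Formula) : Formula := l.foldr or (neg top)

theorem erase_erase_var (s : Finset Var) : (s.erase 1).erase 0 = ∅ := by
  revert s; decide

theorem isSentence_allxy (φ : Formula) : (allxy φ).IsSentence := erase_erase_var _

theorem isSentence_exxy (φ : Formula) : (exxy φ).IsSentence := erase_erase_var _

theorem IsSentence.and {φ ψ : Formula} (hφ : φ.IsSentence) (hψ : ψ.IsSentence) :
    (φ.and ψ).IsSentence := by
  unfold IsSentence at *
  simp [freeVars, hφ, hψ]

theorem isSentence_conj {l : List Formula} (h : ∀ φ ∈ l, φ.IsSentence) : (conj l).IsSentence := by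
  induction l with
  | nil => exact isSentence_allxy _
  | cons φ l ih =>
    exact (h φ (by simp)).and (ih fun ψ hψ => h ψ (by simp [hψ]))

theorem primrec_of_encode {α : Type*} [Primcodable α] {f : α → Formula}
    (h : Primrec fun a => (f a).toNat) : Primrec f :=
  Primrec.encode_iff.1 h

theorem primrec_toNat : Primrec toNat := Primrec.encode

open Primrec in
theorem primrec_step (t : ℕ) {α : Type*} [Primcodable α] {f : α → ℕ} (hf : Primrec f) :
    Primrec fun a => 16 + (11 * f a + t) :=
  nat_add.comp (.const 16) (nat_add.comp (nat_mul.comp (.const 11) hf) (.const t))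

section
variable {α : Type*} [Primcodable α] {f g : α → Formula} {p : α → ℕ}

theorem primrec_pred (hp : Primrec p) (v : Var) : Primrec fun a => pred (p a) v :=
  primrec_of_encode (primrec_step v.val hp)

theorem primrec_and (hf : Primrec f) (hg : Primrec g) : Primrec fun a => and (f a) (g a) :=
  primrec_of_encode (primrec_step 3
    (Primrec₂.natPair.comp (primrec_toNat.comp hf) (primrec_toNat.comp hg)))

theorem primrec_or (hf : Primrec f) (hg : Primrec g) : Primrec fun a => or (f a) (g a) :=
  primrec_of_encode (primrec_step 4
    (Primrec₂.natPair.comp (primrec_toNat.comp hf) (primrec_toNat.comp hg)))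

theorem primrec_imp (hf : Primrec f) (hg : Primrec g) : Primrec fun a => imp (f a) (g a) :=
  primrec_of_encode (primrec_step 5
    (Primrec₂.natPair.comp (primrec_toNat.comp hf) (primrec_toNat.comp hg)))

theorem primrec_all (v : Var) (hf : Primrec f) : Primrec fun a => all v (f a) :=
  primrec_of_encode (primrec_step (7 + v.val) (primrec_toNat.comp hf))

theorem primrec_allxy (hf : Primrec f) : Primrec fun a => allxy (f a) :=
  primrec_all _ (primrec_all _ hf)

theorem primrec_conj : Primrec conj :=
  Primrec.list_foldr (f := id) (g := fun _ => top) (h := fun _ p => and p.1 p.2)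
    .id (.const _) (primrec_and (Primrec.fst.comp Primrec.snd) (Primrec.snd.comp Primrec.snd))

theorem primrec_disj : Primrec disj :=
  Primrec.list_foldr (f := id) (g := fun _ => neg top) (h := fun _ p => or p.1 p.2)
    .id (.const _) (primrec_or (Primrec.fst.comp Primrec.snd) (Primrec.snd.comp Primrec.snd))

/-- A conjunction of fixed shape whose members depend primitive recursively on a parameter. -/
theorem primrec_conj_map {β : Type*} (l : List β) {F : β → α → Formula} (h : ∀ b, Primrec (F b)) :
    Primrec fun a => conj (l.map fun b => F b a) := by
  induction l with
  | nil => exact .const _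
  | cons b l ih => exact primrec_and (h b) ih

end

end Formula

/-! ### Truth of the derived formulas. -/

namespace Str
open Formula
variable {A : Type} (𝔄 : Str A)

/-- Truth of a formula under the assignment `x ↦ a`, `y ↦ b`. -/
def At (φ : Formula) (a b : A) : Prop := 𝔄.Holds φ ![a, b]

theorem update_one (a b c : A) : Function.update (![a, b] : Var → A) 1 c = ![a, c] := by
  funext i; fin_cases i <;> simp

theorem update_update (s : Var → A) (a b : A) :
    Function.update (Function.update s 0 a) 1 b = ![a, b] := by
  funext i; fin_cases i <;> simp

theorem holds_allxy (φ : Formula) (s : Var → A) :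
    𝔄.Holds (allxy φ) s ↔ ∀ a b, 𝔄.At φ a b := by
  simp only [allxy, Holds, update_update, At]

theorem holds_exxy (φ : Formula) (s : Var → A) :
    𝔄.Holds (exxy φ) s ↔ ∃ a b, 𝔄.At φ a b := by
  simp only [exxy, Holds, update_update, At]

theorem holds_top (s : Var → A) : 𝔄.Holds top s := by
  rw [top, holds_allxy]; intro a b h; exact h

theorem holds_conj (l : List Formula) (s : Var → A) :
    𝔄.Holds (conj l) s ↔ ∀ φ ∈ l, 𝔄.Holds φ s := by
  induction l with
  | nil => simpa [conj] using 𝔄.holds_top s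
  | cons φ l ih => simp only [List.forall_mem_cons, ← ih]; rfl

theorem holds_disj (l : List Formula) (s : Var → A) :
    𝔄.Holds (disj l) s ↔ ∃ φ ∈ l, 𝔄.Holds φ s := by
  induction l with
  | nil => simpa [disj, Holds] using 𝔄.holds_top s
  | cons φ l ih => simp only [List.exists_mem_cons_iff, ← ih]; rfl

variable (φ ψ : Formula) (a b : A)

theorem at_top : 𝔄.At top a b := 𝔄.holds_top _
theorem at_pred_zero (p : ℕ) : 𝔄.At (Formula.pred p 0) a b ↔ 𝔄.pred p a := Iff.rfl
theorem at_pred_one (p : ℕ) : 𝔄.At (Formula.pred p 1) a b ↔ 𝔄.pred p b := Iff.rfl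
theorem at_rel (r : EqSym) : 𝔄.At (rel r 0 1) a b ↔ 𝔄.interp r a b := Iff.rfl
theorem at_neg : 𝔄.At (neg φ) a b ↔ ¬ 𝔄.At φ a b := Iff.rfl
theorem at_and : 𝔄.At (and φ ψ) a b ↔ 𝔄.At φ a b ∧ 𝔄.At ψ a b := Iff.rfl
theorem at_imp : 𝔄.At (imp φ ψ) a b ↔ (𝔄.At φ a b → 𝔄.At ψ a b) := Iff.rfl
theorem at_iff : 𝔄.At (iff φ ψ) a b ↔ (𝔄.At φ a b ↔ 𝔄.At ψ a b) := Iff.rfl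
theorem at_ex_one : 𝔄.At (ex 1 φ) a b ↔ ∃ c, 𝔄.At φ a c := by
  simp only [At, Holds, update_one]
theorem at_disj (l : List Formula) : 𝔄.At (disj l) a b ↔ ∃ φ ∈ l, 𝔄.At φ a b :=
  𝔄.holds_disj l _
theorem at_conj (l : List Formula) : 𝔄.At (conj l) a b ↔ ∀ φ ∈ l, 𝔄.At φ a b :=
  𝔄.holds_conj l _

end Str

/-! ### Counting systems and the sentences that describe their runs. -/

/-- A colour `(i, j, l)` of points: a point of this colour leads from a vertex of kind `i` to a
vertex of kind `j`; `l` distinguishes parallel points. -/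
abbrev Color (K : ℕ) := Fin 3 × Fin 3 × Fin K

/-- A nondeterministic machine whose configurations consist of a state and a vector in `ℕ³`.
A step from `(q, n)` to `(q', n')` requires `q' ∈ next q` and the equality of the row vectors
`n * out q` and `n' * inn q'`. -/
structure CountingSystem where
  Q : Type
  mat : Bool → Q → Fin 3 → Fin 3 → ℕ
  next : Q → List Q
  idx : Q → ℕ
  start : Q
  states : List Q
  finals : List Q

namespace CountingSystem

variable (Y : CountingSystem)

/-- The outgoing matrix of a state. -/
abbrev out : Y.Q → Fin 3 → Fin 3 → ℕ := Y.mat true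

/-- The incoming matrix of a state. -/
abbrev inn : Y.Q → Fin 3 → Fin 3 → ℕ := Y.mat false

/-- The vector equation of a step from state `q` to state `q'`. -/
def Balanced (q q' : Y.Q) (n n' : Fin 3 → ℕ) : Prop :=
  ∀ j, ∑ i, Y.out q i j * n i = ∑ i, Y.inn q' i j * n' i

end CountingSystem

section Formulas
open Formula

variable {K : ℕ}

/-- The predicate symbol for points of a given polarity and colour. -/
def colIdx (b : Bool) (e : Color K) : ℕ := 2 * Encodable.encode (b, e)

theorem colIdx_inj {b b' : Bool} {e e' : Color K} : colIdx b e = colIdx b' e' ↔ b = b' ∧ e = e' := by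
  simp [colIdx]

def colF (b : Bool) (e : Color K) (v : Var) : Formula := pred (colIdx b e) v
def stF (s : ℕ) (v : Var) : Formula := pred (2 * s + 1) v

noncomputable def colors (K : ℕ) : List (Bool × Color K) := Finset.univ.toList

theorem mem_colors (p : Bool × Color K) : p ∈ colors K := by simp [colors]

noncomputable def ordColors (K : ℕ) : List (Color K) := Finset.univ.toList

theorem mem_ordColors (p : Color K) : p ∈ ordColors K := by simp [ordColors]

/-- For points of one polarity, configurations and steps coincide (`E2` and `F2`). For one colour as
well, vertices and edges coincide (`E1` and `F1`); this replaces the statement that a vertex carries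
at most one edge of each colour, which would need equality. Sources are determined by vertices,
targets by edges. -/
def pairRule (p p' : Bool × Color K) : Formula :=
  allxy (imp (and (colF p.1 p.2 0) (colF p'.1 p'.2 1)) (conj
    [if p.1 = p'.1 then iff (rel .E2 0 1) (rel .F2 0 1) else top,
     if p.1 = p'.1 ∧ p.2 = p'.2 then iff (rel .E1 0 1) (rel .F1 0 1) else top,
     if p.1 = p'.1 ∧ p.2 ≠ p'.2 then neg (rel .F1 0 1) else top,
     if p.2.2.1 ≠ p'.2.2.1 then neg (rel .F1 0 1) else top,
     if p.2.1 ≠ p'.2.1 then neg (rel .E1 0 1) else top]))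

noncomputable def matchRule (p : Bool × Color K) : Formula :=
  allxy (imp (colF p.1 p.2 0) (ex 1 (and (rel .F1 0 1)
    (disj (((ordColors K).filter fun e => e.2.1 = p.2.2.1).map fun e => colF (!p.1) e 1)))))

/-- The rules that do not depend on the system. -/
noncomputable def commonRules (K : ℕ) : Formula :=
  and (conj ((colors K).map fun p => conj ((colors K).map fun p' => pairRule p p')))
    (conj ((colors K).map matchRule))

def spreadRule (s : ℕ) : Formula :=
  allxy (imp (and (stF s 0) (rel .E2 0 1)) (stF s 1))

/-- A vertex exists only through its points, so any point `p₀` with the right source, of either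
polarity, has to trigger the demand for an edge of colour `p`. -/
noncomputable def degreeRule (M : Bool → Fin 3 → Fin 3 → ℕ) (p : Bool × Color K) (s : ℕ) : Formula :=
  if p.2.2.2.val < M p.1 p.2.1 p.2.2.1 then
    conj (((colors K).filter fun p₀ => p₀.2.1 = p.2.1).map fun p₀ =>
      allxy (imp (and (stF s 0) (colF p₀.1 p₀.2 0))
        (ex 1 (and (rel .E1 0 1) (colF p.1 p.2 1)))))
  else allxy (imp (stF s 0) (neg (colF p.1 p.2 0)))

def nextRule (next : List ℕ) (e e' : Color K) (s : ℕ) : Formula :=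
  allxy (imp (and (and (stF s 0) (colF true e 0)) (and (colF false e' 1) (rel .F2 0 1)))
    (disj (next.map fun s' => stF s' 1)))

/-- The rules for state number `s` with matrices `M` and successor states `next`. -/
noncomputable def stateRules (K : ℕ) (M : Bool → Fin 3 → Fin 3 → ℕ) (next : List ℕ) (s : ℕ) :
    Formula :=
  and (spreadRule s) (and (conj ((colors K).map fun p => degreeRule M p s))
    (conj ((ordColors K).map fun e => conj ((ordColors K).map fun e' => nextRule next e e' s))))

/-- The rules for the initial state. -/
def startRules (e : Color K) (s : ℕ) : Formula :=
  and (exxy (and (stF s 0) (colF true e 0)))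
    (allxy (imp (and (stF s 0) (and (stF s 1) (rel .E2 0 1))) (rel .E1 0 1)))

/-- No state from the list occurs. -/
def avoidRules (l : List ℕ) : Formula := conj (l.map fun s => allxy (neg (stF s 0)))

end Formulas

namespace CountingSystem
open Formula

variable {K : ℕ} (Y : CountingSystem)

/-- The sentence describing the complete runs of the system. -/
noncomputable def runSentence (hK : 0 < K) : Formula :=
  and (commonRules K) (and (startRules ((0, 0, ⟨0, hK⟩) : Color K) (Y.idx Y.start))
    (conj (Y.states.map fun q =>
      stateRules K (fun b => Y.mat b q) ((Y.next q).map Y.idx) (Y.idx q))))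

/-- The sentence describing the complete runs without final state. -/
noncomputable def infiniteRunSentence (hK : 0 < K) : Formula :=
  and (Y.runSentence hK) (avoidRules (Y.finals.map Y.idx))

/-- The structure is a model of the rules of the system. -/
structure Models {A : Type} (hK : 0 < K) (𝔄 : Str A) : Prop where
  pair : ∀ b b' (e e' : Color K) x y, 𝔄.pred (colIdx b e) x → 𝔄.pred (colIdx b' e') y →
    (b = b' → (𝔄.E2.r x y ↔ 𝔄.F2.r x y)) ∧
    (b = b' ∧ e = e' → (𝔄.E1.r x y ↔ 𝔄.F1.r x y)) ∧
    (b = b' ∧ e ≠ e' → ¬ 𝔄.F1.r x y) ∧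
    (e.2.1 ≠ e'.2.1 → ¬ 𝔄.F1.r x y) ∧
    (e.1 ≠ e'.1 → ¬ 𝔄.E1.r x y)
  matched : ∀ b (e : Color K) x, 𝔄.pred (colIdx b e) x →
    ∃ y, 𝔄.F1.r x y ∧ ∃ e' : Color K, e'.2.1 = e.2.1 ∧ 𝔄.pred (colIdx (!b) e') y
  spread : ∀ q ∈ Y.states, ∀ x y, 𝔄.pred (2 * Y.idx q + 1) x → 𝔄.E2.r x y →
    𝔄.pred (2 * Y.idx q + 1) y
  degree : ∀ q ∈ Y.states, ∀ b (e : Color K) b₀ (e₀ : Color K), e₀.1 = e.1 →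
    e.2.2.val < Y.mat b q e.1 e.2.1 → ∀ x, 𝔄.pred (2 * Y.idx q + 1) x → 𝔄.pred (colIdx b₀ e₀) x →
    ∃ y, 𝔄.E1.r x y ∧ 𝔄.pred (colIdx b e) y
  degree_lt : ∀ q ∈ Y.states, ∀ b (e : Color K) x, 𝔄.pred (2 * Y.idx q + 1) x →
    𝔄.pred (colIdx b e) x → e.2.2.val < Y.mat b q e.1 e.2.1
  next : ∀ q ∈ Y.states, ∀ (e e' : Color K) x y, 𝔄.pred (2 * Y.idx q + 1) x →
    𝔄.pred (colIdx true e) x → 𝔄.pred (colIdx false e') y → 𝔄.F2.r x y →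
    ∃ q' ∈ Y.next q, 𝔄.pred (2 * Y.idx q' + 1) y
  start : ∃ x, 𝔄.pred (2 * Y.idx Y.start + 1) x ∧
    𝔄.pred (colIdx true ((0, 0, ⟨0, hK⟩) : Color K)) x
  start_unique : ∀ x y, 𝔄.pred (2 * Y.idx Y.start + 1) x → 𝔄.pred (2 * Y.idx Y.start + 1) y →
    𝔄.E2.r x y → 𝔄.E1.r x y

end CountingSystem

theorem exists_mem_map {α β : Type*} {f : α → β} {l : List α} {P : β → Prop} :
    (∃ b ∈ l.map f, P b) ↔ ∃ a ∈ l, P (f a) := by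
  simp

/-! ### What the rules say about a structure. -/

section
open Formula Str
variable {A : Type} [Nonempty A] (𝔄 : Str A) {K : ℕ}

theorem isModel_allxy (φ : Formula) : 𝔄.IsModel (allxy φ) ↔ ∀ a b, 𝔄.At φ a b := by
  simp [IsModel, holds_allxy]

theorem isModel_exxy (φ : Formula) : 𝔄.IsModel (exxy φ) ↔ ∃ a b, 𝔄.At φ a b := by
  simp [IsModel, holds_exxy]

omit [Nonempty A] in
theorem isModel_and (φ ψ : Formula) : 𝔄.IsModel (and φ ψ) ↔ 𝔄.IsModel φ ∧ 𝔄.IsModel ψ :=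
  forall_and

omit [Nonempty A] in
theorem isModel_conj (l : List Formula) : 𝔄.IsModel (conj l) ↔ ∀ φ ∈ l, 𝔄.IsModel φ := by
  simp only [IsModel, holds_conj]
  exact ⟨fun h φ hφ s => h s φ hφ, fun h s φ hφ => h φ hφ s⟩

omit [Nonempty A] in
theorem at_ite (P : Prop) [Decidable P] (φ : Formula) (a b : A) :
    𝔄.At (if P then φ else top) a b ↔ (P → 𝔄.At φ a b) := by
  split_ifs with h <;> simp [h, at_top]

theorem isModel_pairRule (p p' : Bool × Color K) : 𝔄.IsModel (pairRule p p') ↔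
    ∀ x y, 𝔄.pred (colIdx p.1 p.2) x → 𝔄.pred (colIdx p'.1 p'.2) y →
    (p.1 = p'.1 → (𝔄.E2.r x y ↔ 𝔄.F2.r x y)) ∧
    (p.1 = p'.1 ∧ p.2 = p'.2 → (𝔄.E1.r x y ↔ 𝔄.F1.r x y)) ∧
    (p.1 = p'.1 ∧ p.2 ≠ p'.2 → ¬ 𝔄.F1.r x y) ∧
    (p.2.2.1 ≠ p'.2.2.1 → ¬ 𝔄.F1.r x y) ∧
    (p.2.1 ≠ p'.2.1 → ¬ 𝔄.E1.r x y) := by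
  simp only [pairRule, isModel_allxy, at_imp, at_and, at_conj, colF, at_pred_zero, at_pred_one,
    List.forall_mem_cons, at_ite, at_iff, at_neg, at_rel, interp, and_imp]
  simp

theorem isModel_matchRule (p : Bool × Color K) : 𝔄.IsModel (matchRule p) ↔
    ∀ x, 𝔄.pred (colIdx p.1 p.2) x →
    ∃ y, 𝔄.F1.r x y ∧ ∃ e' : Color K, e'.2.1 = p.2.2.1 ∧ 𝔄.pred (colIdx (!p.1) e') y := by
  simp only [matchRule, isModel_allxy, at_imp, at_and, at_disj, colF, at_pred_zero, at_ex_one,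
    at_rel, interp, List.mem_map, List.mem_filter, mem_ordColors, true_and, decide_eq_true_eq]
  simp [at_pred_one]

theorem isModel_spreadRule (s : ℕ) : 𝔄.IsModel (spreadRule s) ↔
    ∀ x y, 𝔄.pred (2 * s + 1) x → 𝔄.E2.r x y → 𝔄.pred (2 * s + 1) y := by
  simp only [spreadRule, isModel_allxy, at_imp, at_and, stF, at_pred_zero, at_pred_one,
    at_rel, interp, and_imp]

theorem isModel_degreeRule (M : Bool → Fin 3 → Fin 3 → ℕ) (p : Bool × Color K) (s : ℕ) :
    𝔄.IsModel (degreeRule M p s) ↔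
    (∀ p₀ : Bool × Color K, p₀.2.1 = p.2.1 → p.2.2.2.val < M p.1 p.2.1 p.2.2.1 →
      ∀ x, 𝔄.pred (2 * s + 1) x → 𝔄.pred (colIdx p₀.1 p₀.2) x →
      ∃ y, 𝔄.E1.r x y ∧ 𝔄.pred (colIdx p.1 p.2) y) ∧
    (∀ x, 𝔄.pred (2 * s + 1) x → 𝔄.pred (colIdx p.1 p.2) x →
      p.2.2.2.val < M p.1 p.2.1 p.2.2.1) := by
  unfold degreeRule
  split_ifs with h
  · simp only [isModel_conj, List.forall_mem_map, isModel_allxy, at_imp, at_and, at_ex_one,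
      stF, colF, at_pred_zero, at_pred_one, at_rel, interp, List.mem_filter, mem_colors, true_and,
      decide_eq_true_eq, h, and_imp, implies_true, and_true, forall_const]
  · simp only [isModel_allxy, at_imp, stF, colF, at_pred_zero, at_neg, h, IsEmpty.forall_iff,
      implies_true, true_and, imp_false, forall_const]

theorem isModel_nextRule (l : List ℕ) (e e' : Color K) (s : ℕ) :
    𝔄.IsModel (nextRule l e e' s) ↔ ∀ x y, 𝔄.pred (2 * s + 1) x →
    𝔄.pred (colIdx true e) x → 𝔄.pred (colIdx false e') y → 𝔄.F2.r x y →
    ∃ s' ∈ l, 𝔄.pred (2 * s' + 1) y := by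
  simp only [nextRule, isModel_allxy, at_imp, at_and, at_disj, stF, colF, at_pred_zero,
    at_pred_one, at_rel, interp, exists_mem_map, and_imp]

theorem isModel_startRules (e : Color K) (s : ℕ) : 𝔄.IsModel (startRules e s) ↔
    (∃ x, 𝔄.pred (2 * s + 1) x ∧ 𝔄.pred (colIdx true e) x) ∧
    ∀ x y, 𝔄.pred (2 * s + 1) x → 𝔄.pred (2 * s + 1) y → 𝔄.E2.r x y → 𝔄.E1.r x y := by
  simp only [startRules, isModel_and, isModel_allxy, isModel_exxy, at_imp, at_and, stF, colF,
    at_pred_zero, at_pred_one, at_rel, interp, and_imp, exists_const]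

theorem isModel_avoidRules (l : List ℕ) : 𝔄.IsModel (avoidRules l) ↔
    ∀ s ∈ l, ∀ x, ¬ 𝔄.pred (2 * s + 1) x := by
  simp only [avoidRules, isModel_conj, List.forall_mem_map, isModel_allxy, at_neg, stF,
    at_pred_zero, forall_const]

omit [Nonempty A] in
theorem isModel_stateRules (M : Bool → Fin 3 → Fin 3 → ℕ) (l : List ℕ) (s : ℕ) :
    𝔄.IsModel (stateRules K M l s) ↔ 𝔄.IsModel (spreadRule s) ∧
      (∀ p : Bool × Color K, 𝔄.IsModel (degreeRule M p s)) ∧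
      ∀ e e' : Color K, 𝔄.IsModel (nextRule l e e' s) := by
  simp only [stateRules, isModel_and, isModel_conj, List.forall_mem_map, mem_colors, mem_ordColors,
    forall_const]

theorem CountingSystem.isModel_runSentence (Y : CountingSystem) (hK : 0 < K) :
    𝔄.IsModel (Y.runSentence hK) ↔ Y.Models hK 𝔄 := by
  simp only [runSentence, commonRules, isModel_and, isModel_conj, List.forall_mem_map, mem_colors,
    forall_const, isModel_pairRule, isModel_matchRule, isModel_startRules, isModel_stateRules,
    isModel_spreadRule, isModel_degreeRule, isModel_nextRule, exists_mem_map]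
  constructor
  · rintro ⟨⟨h1, h2⟩, ⟨h3, h4⟩, h5⟩
    exact ⟨fun b b' e e' => h1 (b, e) (b', e'), fun b e => h2 (b, e), fun q hq => (h5 q hq).1,
      fun q hq b e b₀ e₀ => ((h5 q hq).2.1 (b, e)).1 (b₀, e₀),
      fun q hq b e => ((h5 q hq).2.1 (b, e)).2, fun q hq => (h5 q hq).2.2, h3, h4⟩
  · intro h
    exact ⟨⟨fun p p' => h.pair _ _ _ _, fun p => h.matched _ _⟩, ⟨h.start, h.start_unique⟩,
      fun q hq => ⟨h.spread q hq, fun p => ⟨fun p₀ => h.degree q hq _ _ _ _, h.degree_lt q hq _ _⟩,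
        h.next q hq⟩⟩

theorem CountingSystem.isModel_infiniteRunSentence (Y : CountingSystem) (hK : 0 < K) :
    𝔄.IsModel (Y.infiniteRunSentence hK) ↔
      Y.Models hK 𝔄 ∧ ∀ q ∈ Y.finals, ∀ x, ¬ 𝔄.pred (2 * Y.idx q + 1) x := by
  simp only [infiniteRunSentence, isModel_and, isModel_runSentence, isModel_avoidRules,
    List.forall_mem_map]

end

/-! ### The rules are sentences and depend primitive recursively on state numbers. -/

section
open Formula
variable {K : ℕ}

theorem isSentence_conj_map {α : Type*} {l : List α} {f : α → Formula}
    (h : ∀ a, (f a).IsSentence) : (conj (l.map f)).IsSentence :=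
  isSentence_conj (by simpa using fun a _ => h a)

theorem CountingSystem.isSentence_runSentence (Y : CountingSystem) (hK : 0 < K) :
    (Y.runSentence hK).IsSentence := by
  refine .and (.and (isSentence_conj_map fun _ => isSentence_conj_map fun _ => isSentence_allxy _)
    (isSentence_conj_map fun _ => isSentence_allxy _))
    (.and (.and (isSentence_exxy _) (isSentence_allxy _)) (isSentence_conj_map fun _ =>
      .and (isSentence_allxy _) (.and (isSentence_conj_map fun _ => ?_)
      (isSentence_conj_map fun _ => isSentence_conj_map fun _ => isSentence_allxy _))))
  unfold degreeRule
  split_ifs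
  · exact isSentence_conj_map fun _ => isSentence_allxy _
  · exact isSentence_allxy _

theorem CountingSystem.isSentence_infiniteRunSentence (Y : CountingSystem) (hK : 0 < K) :
    (Y.infiniteRunSentence hK).IsSentence :=
  .and (Y.isSentence_runSentence hK) (isSentence_conj_map fun _ => isSentence_allxy _)

variable {α : Type*} [Primcodable α] {f : α → ℕ} {g : α → List ℕ}

theorem primrec_stF (hf : Primrec f) (v : Var) : Primrec fun a => stF (f a) v :=
  primrec_pred (Primrec.nat_add.comp (Primrec.nat_mul.comp (.const 2) hf) (.const 1)) v

theorem primrec_degreeRule (M : Bool → Fin 3 → Fin 3 → ℕ) (p : Bool × Color K) (hf : Primrec f) :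
    Primrec fun a => degreeRule M p (f a) := by
  unfold degreeRule
  split_ifs
  · exact primrec_conj_map _ fun _ => primrec_allxy
      (primrec_imp (primrec_and (primrec_stF hf 0) (.const _)) (.const _))
  · exact primrec_allxy (primrec_imp (primrec_stF hf 0) (.const _))

theorem primrec_nextRule (e e' : Color K) (hg : Primrec g) (hf : Primrec f) :
    Primrec fun a => nextRule (g a) e e' (f a) :=
  primrec_allxy (primrec_imp (primrec_and (primrec_and (primrec_stF hf 0) (.const _)) (.const _))
    (primrec_disj.comp (Primrec.list_map hg (primrec_stF Primrec.snd 1).to₂)))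

theorem primrec_stateRules (M : Bool → Fin 3 → Fin 3 → ℕ) (hg : Primrec g) (hf : Primrec f) :
    Primrec fun a => stateRules K M (g a) (f a) :=
  primrec_and
    (primrec_allxy (primrec_imp (primrec_and (primrec_stF hf 0) (.const _)) (primrec_stF hf 1)))
    (primrec_and (primrec_conj_map _ fun p => primrec_degreeRule M p hf)
      (primrec_conj_map _ fun e => primrec_conj_map _ fun e' => primrec_nextRule e e' hg hf))

end

/-! ### Counting edges. -/

/-- Two maps with the same kernel on `P` have images in bijection: both images are injective
projections of the image of the paired map. -/
theorem ncard_image_eq_of_iff {α β γ : Type*} {P : Set α} {f : α → β} {g : α → γ}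
    (h : ∀ x ∈ P, ∀ y ∈ P, f x = f y ↔ g x = g y) :
    (f '' P).ncard = (g '' P).ncard ∧ ((f '' P).Finite ↔ (g '' P).Finite) := by
  have hf : f '' P = Prod.fst '' ((fun x => (f x, g x)) '' P) := by simp [Set.image_image]
  have hg : g '' P = Prod.snd '' ((fun x => (f x, g x)) '' P) := by simp [Set.image_image]
  have if' : Set.InjOn Prod.fst ((fun x => (f x, g x)) '' P) := by
    rintro _ ⟨x, hx, rfl⟩ _ ⟨y, hy, rfl⟩ e
    exact Prod.ext e ((h x hx y hy).1 e)
  have ig : Set.InjOn Prod.snd ((fun x => (f x, g x)) '' P) := by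
    rintro _ ⟨x, hx, rfl⟩ _ ⟨y, hy, rfl⟩ e
    exact Prod.ext ((h x hx y hy).2 e) e
  rw [hf, hg, Set.InjOn.ncard_image if', Set.InjOn.ncard_image ig,
    Set.finite_image_iff if', Set.finite_image_iff ig]
  exact ⟨rfl, Iff.rfl⟩

/-- The edges to vertices of kind `j` that a matrix prescribes for given sets of vertices. -/
def edges {α : Type*} (K : ℕ) (V : Fin 3 → Set α) (M : Fin 3 → Fin 3 → ℕ) (j : Fin 3) :
    Set (α × Color K) :=
  {p | p.1 ∈ V p.2.1 ∧ p.2.2.2.val < M p.2.1 p.2.2.1 ∧ p.2.2.1 = j}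

section
variable {α : Type*} {K : ℕ} {V : Fin 3 → Set α} {M : Fin 3 → Fin 3 → ℕ}

def edgesEquiv (hM : ∀ i j, M i j ≤ K) (j : Fin 3) :
    edges K V M j ≃ Σ i, Fin (M i j) × V i where
  toFun p := ⟨p.1.2.1, ⟨p.1.2.2.2, by have := p.2.2.1; rwa [p.2.2.2] at this⟩, ⟨p.1.1, p.2.1⟩⟩
  invFun p := ⟨(p.2.2.1, p.1, j, Fin.castLE (hM _ _) p.2.1), p.2.2.2, p.2.1.2, rfl⟩
  left_inv := by rintro ⟨⟨v, i, j', l⟩, h1, h2, h3⟩; cases h3; rfl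
  right_inv := by rintro ⟨i, l, v⟩; rfl

theorem finite_edges (hM : ∀ i j, M i j ≤ K) (hV : ∀ i, (V i).Finite) (j : Fin 3) :
    (edges K V M j).Finite := by
  have := fun i => (hV i).to_subtype
  exact Finite.of_equiv _ (edgesEquiv hM j).symm

theorem ncard_edges (hM : ∀ i j, M i j ≤ K) (hV : ∀ i, (V i).Finite) (j : Fin 3) :
    (edges K V M j).ncard = ∑ i, M i j * (V i).ncard := by
  have := fun i => (hV i).to_subtype
  rw [← Nat.card_coe_set_eq, Nat.card_congr (edgesEquiv hM j), Nat.card_sigma]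
  simp [Nat.card_prod, Nat.card_coe_set_eq]

/-- A positive diagonal entry gives every vertex of kind `j` an edge of its own. This carries
finiteness from one configuration to the next. -/
theorem finite_of_finite_edges {j : Fin 3} (hM : ∀ i j, M i j ≤ K) (hj : 0 < M j j)
    (h : (edges K V M j).Finite) : (V j).Finite := by
  have hinj : Set.InjOn (fun v => ((v, j, j, ⟨0, hj.trans_le (hM j j)⟩) : α × Color K)) (V j) :=
    fun u _ v _ e => (Prod.ext_iff.1 e).1
  refine (Set.finite_image_iff hinj).1 (h.subset ?_)
  rintro _ ⟨v, hv, rfl⟩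
  exact ⟨hv, hj, rfl⟩

end

/-! ### From models to runs. -/

namespace CountingSystem

variable {Y : CountingSystem} {K : ℕ} {A : Type} {𝔄 : Str A}

variable (K 𝔄) in
/-- The vertices of kind `i` of the configuration of a point. -/
def vertices (x₀ : A) (i : Fin 3) : Set (Quotient 𝔄.E1) :=
  {u | ∃ x b, ∃ e : Color K, 𝔄.E2.r x₀ x ∧ 𝔄.pred (colIdx b e) x ∧ e.1 = i ∧
    Quotient.mk 𝔄.E1 x = u}

variable (K 𝔄) in
/-- The coloured points of given polarity in the configuration of a point that lead to kind `j`. -/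
def points (b : Bool) (x₀ : A) (j : Fin 3) : Set (A × Color K) :=
  {p | 𝔄.E2.r x₀ p.1 ∧ 𝔄.pred (colIdx b p.2) p.1 ∧ p.2.2.1 = j}

variable (K 𝔄) in
/-- The configuration of the point `x` precedes the one of `y`. -/
def Precedes (x y : A) : Prop :=
  ∃ x', ∃ e e' : Color K, 𝔄.E2.r x x' ∧ 𝔄.pred (colIdx true e) x' ∧
    𝔄.pred (colIdx false e') y ∧ 𝔄.F2.r x' y

variable (Y K 𝔄) in
/-- The configuration of the point `x` has state `q` and vector `n`. -/
def Represents (x : A) (q : Y.Q) (n : Fin 3 → ℕ) : Prop :=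
  𝔄.pred (2 * Y.idx q + 1) x ∧ ∀ i, (vertices K 𝔄 x i).Finite ∧ (vertices K 𝔄 x i).ncard = n i

namespace Models

variable {hK : 0 < K} (h : Y.Models hK 𝔄)
include h

/-- The degree rules make the coloured points of a configuration realise exactly the edges that its
state prescribes, each possibly by several points. -/
theorem image_points {q : Y.Q} (hq : q ∈ Y.states) (b : Bool) {x₀ : A}
    (hx₀ : 𝔄.pred (2 * Y.idx q + 1) x₀) (j : Fin 3) :
    (fun p : A × Color K => (Quotient.mk 𝔄.E1 p.1, p.2)) '' points K 𝔄 b x₀ j =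
      edges K (vertices K 𝔄 x₀) (Y.mat b q) j := by
  ext ⟨u, e⟩
  constructor
  · rintro ⟨⟨x, e'⟩, ⟨h1, h2, h3⟩, he⟩
    obtain ⟨rfl, rfl⟩ := Prod.ext_iff.1 he
    exact ⟨⟨x, b, e', h1, h2, rfl, rfl⟩, h.degree_lt q hq b e' x (h.spread q hq _ _ hx₀ h1) h2, h3⟩
  · rintro ⟨⟨x, b₀, e₀, h1, h2, h3, rfl⟩, h4, h5⟩
    obtain ⟨y, h6, h7⟩ := h.degree q hq b e b₀ e₀ h3 h4 x (h.spread q hq _ _ hx₀ h1) h2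
    exact ⟨(y, e), ⟨𝔄.E2.trans' h1 (𝔄.E1_sub_E2 _ _ h6), h7, h5⟩,
      Prod.ext (Quotient.sound (𝔄.E1.symm' h6)) rfl⟩

/-- Hence an edge of one polarity and an `F1`-class are the same thing, and edges may be counted
through `F1`. -/
theorem points_iff (b : Bool) (x₀ : A) (j : Fin 3) :
    ∀ p ∈ points K 𝔄 b x₀ j, ∀ p' ∈ points K 𝔄 b x₀ j,
      ((Quotient.mk 𝔄.E1 p.1, p.2) = (Quotient.mk 𝔄.E1 p'.1, p'.2)) ↔
        Quotient.mk 𝔄.F1 p.1 = Quotient.mk 𝔄.F1 p'.1 := by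
  rintro ⟨x, e⟩ ⟨-, h1, -⟩ ⟨y, e'⟩ ⟨-, h2, -⟩
  have h3 := h.pair b b e e' x y h1 h2
  simp only [Prod.mk.injEq, Quotient.eq]
  by_cases he : e = e'
  · simpa [he] using h3.2.1 ⟨rfl, he⟩
  · simpa [he] using h3.2.2.1 ⟨rfl, he⟩

/-- The `F1`-partner of a point has the opposite polarity and the same target, and lies in the same
`F2`-class since `F1 ⊆ F2`. As `E2` and `F2` agree on each polarity, it falls into the other of the
two configurations. -/
theorem image_points_of_precedes {x₀ y₀ : A} (hp : Precedes K 𝔄 x₀ y₀) (j : Fin 3) :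
    (fun p : A × Color K => Quotient.mk 𝔄.F1 p.1) '' points K 𝔄 true x₀ j =
      (fun p : A × Color K => Quotient.mk 𝔄.F1 p.1) '' points K 𝔄 false y₀ j := by
  obtain ⟨x', e, e', h1, h2, h3, h4⟩ := hp
  ext w
  constructor
  · rintro ⟨⟨x, c⟩, ⟨h5, h6, h7⟩, rfl⟩
    obtain ⟨y, h8, c', h9, h10⟩ := h.matched true c x h6
    refine ⟨(y, c'), ⟨?_, h10, h9.trans h7⟩, Quotient.sound (𝔄.F1.symm' h8)⟩
    refine ((h.pair false false e' c' y₀ y h3 h10).1 rfl).2 ?_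
    refine 𝔄.F2.trans' (𝔄.F2.symm' h4) (𝔄.F2.trans' ?_ (𝔄.F1_sub_F2 _ _ h8))
    exact ((h.pair true true e c x' x h2 h6).1 rfl).1 (𝔄.E2.trans' (𝔄.E2.symm' h1) h5)
  · rintro ⟨⟨y, c⟩, ⟨h5, h6, h7⟩, rfl⟩
    obtain ⟨x, h8, c', h9, h10⟩ := h.matched false c y h6
    refine ⟨(x, c'), ⟨?_, h10, h9.trans h7⟩, Quotient.sound (𝔄.F1.symm' h8)⟩
    refine 𝔄.E2.trans' h1 (((h.pair true true e c' x' x h2 h10).1 rfl).2 ?_)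
    refine 𝔄.F2.trans' h4 (𝔄.F2.trans' ?_ (𝔄.F1_sub_F2 _ _ h8))
    exact ((h.pair false false e' c y₀ y h3 h6).1 rfl).1 h5

/-- In a model the configuration of a nonfinal state has a successor configuration. -/
theorem exists_represents (hle : ∀ b q i j, Y.mat b q i j ≤ K)
    {x : A} {q : Y.Q} {n : Fin 3 → ℕ} (hr : Y.Represents K 𝔄 x q n) (hq : q ∈ Y.states)
    (hnext : ∀ q' ∈ Y.next q, q' ∈ Y.states ∧ ∀ i, 0 < Y.inn q' i i)
    (hout : 0 < Y.out q 0 0) (hn : 0 < n 0) :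
    ∃ y, ∃ q' ∈ Y.next q, ∃ n', Y.Balanced q q' n n' ∧ Y.Represents K 𝔄 y q' n' ∧
      Precedes K 𝔄 x y := by
  obtain ⟨hx, hV⟩ := hr
  -- A vertex of kind `0` with an outgoing edge of colour `(0, 0, 0)` supplies the point whose
  -- `F1`-partner lies in the successor.
  obtain ⟨_, x₁, b, e, h1, h2, h3, -⟩ : (vertices K 𝔄 x 0).Nonempty := by
    rw [← Set.ncard_pos (hV 0).1, (hV 0).2]; exact hn
  have hx₁ := h.spread q hq _ _ hx h1
  obtain ⟨x₂, h4, h5⟩ := h.degree q hq true (0, 0, ⟨0, hK⟩) b e h3 hout x₁ hx₁ h2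
  have h6 : 𝔄.E2.r x x₂ := 𝔄.E2.trans' h1 (𝔄.E1_sub_E2 _ _ h4)
  obtain ⟨y, h7, e', -, h8⟩ := h.matched true _ x₂ h5
  have h9 := 𝔄.F1_sub_F2 _ _ h7
  obtain ⟨q', hq', hy⟩ := h.next q hq _ e' x₂ y (h.spread q hq _ _ hx h6) h5 h8 h9
  have hp : Precedes K 𝔄 x y := ⟨x₂, _, e', h6, h5, h8, h9⟩
  obtain ⟨hs, hd⟩ := hnext q' hq'
  have key : ∀ j, (edges K (vertices K 𝔄 x) (Y.out q) j).ncard =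
      (edges K (vertices K 𝔄 y) (Y.inn q') j).ncard ∧
      (edges K (vertices K 𝔄 y) (Y.inn q') j).Finite := by
    intro j
    have hf := finite_edges (hle true q) (fun i => (hV i).1) j
    rw [← h.image_points hq true hx j] at hf ⊢
    rw [← h.image_points hs false hy j]
    have e1 := ncard_image_eq_of_iff (h.points_iff true x j)
    have e2 := ncard_image_eq_of_iff (h.points_iff false y j)
    rw [h.image_points_of_precedes hp j] at e1
    exact ⟨e1.1.trans e2.1.symm, e2.2.2 (e1.2.1 hf)⟩
  have hV' : ∀ i, (vertices K 𝔄 y i).Finite :=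
    fun i => finite_of_finite_edges (hle false q') (hd i) (key i).2
  refine ⟨y, q', hq', fun i => (vertices K 𝔄 y i).ncard, fun j => ?_, ⟨hy, fun i => ⟨hV' i, rfl⟩⟩,
    hp⟩
  rw [← ncard_edges (hle false q') hV' j, ← (key j).1,
    ncard_edges (hle true q) (fun i => (hV i).1) j]
  exact Finset.sum_congr rfl fun i _ => by rw [(hV i).2]

theorem exists_represents_start (hs : Y.start ∈ Y.states) (hinn : ∀ i j, Y.inn Y.start i j = 0)
    (hout : ∀ i j, i ≠ 0 → Y.out Y.start i j = 0) :
    ∃ x, Y.Represents K 𝔄 x Y.start ![1, 0, 0] := by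
  obtain ⟨x, hx, hc⟩ := h.start
  have hsrc : ∀ b (e : Color K) y, 𝔄.pred (2 * Y.idx Y.start + 1) y → 𝔄.pred (colIdx b e) y →
      e.1 = 0 := by
    intro b e y h1 h2
    have h3 := h.degree_lt _ hs b e y h1 h2
    by_contra h4
    cases b
    · exact absurd h3 (by simp [hinn])
    · exact absurd h3 (by simp [hout _ _ h4])
  have h0 : vertices K 𝔄 x 0 = {Quotient.mk 𝔄.E1 x} := by
    ext u
    constructor
    · rintro ⟨y, b, e, h1, h2, h3, rfl⟩
      exact Quotient.sound (𝔄.E1.symm' (h.start_unique x y hx (h.spread _ hs _ _ hx h1) h1))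
    · rintro rfl
      exact ⟨x, true, _, 𝔄.E2.refl' x, hc, rfl, rfl⟩
  have h1 : ∀ i, i ≠ 0 → vertices K 𝔄 x i = ∅ := by
    intro i hi
    rw [Set.eq_empty_iff_forall_notMem]
    rintro u ⟨y, b, e, h1, h2, rfl, rfl⟩
    exact hi (hsrc b e y (h.spread _ hs _ _ hx h1) h2)
  refine ⟨x, hx, fun i => ?_⟩
  fin_cases i
  · simp [h0]
  · simp [h1 1 (by decide)]
  · simp [h1 2 (by decide)]

theorem not_precedes_start (hs : Y.start ∈ Y.states) (hinn : ∀ i j, Y.inn Y.start i j = 0)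
    {x y z : A} (hx : 𝔄.pred (2 * Y.idx Y.start + 1) x) (hp : Precedes K 𝔄 z y) :
    ¬ 𝔄.E2.r x y := by
  intro hxy
  obtain ⟨_, _, e, _, _, h3, _⟩ := hp
  exact absurd (h.degree_lt _ hs false e y (h.spread _ hs _ _ hx hxy) h3) (by simp [hinn])

/-- Predecessors are unique: pass from `E2` to `F2` on incoming points, cross to the outgoing points
inside `F2`, and return to `E2`. -/
theorem rel_of_precedes {x y x' y' : A} (hp : Precedes K 𝔄 x y) (hp' : Precedes K 𝔄 x' y')
    (hy : 𝔄.E2.r y y') : 𝔄.E2.r x x' := by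
  obtain ⟨z, e, c, h1, h2, h3, h4⟩ := hp
  obtain ⟨z', e', c', h1', h2', h3', h4'⟩ := hp'
  have h5 := ((h.pair _ _ _ _ _ _ h3 h3').1 rfl).1 hy
  have h6 := ((h.pair _ _ _ _ _ _ h2 h2').1 rfl).2
    (𝔄.F2.trans' h4 (𝔄.F2.trans' h5 (𝔄.F2.symm' h4')))
  exact 𝔄.E2.trans' h1 (𝔄.E2.trans' h6 (𝔄.E2.symm' h1'))

end Models

end CountingSystem

/-! ### Deterministic runs and their correspondence with models. -/

/-- The edges that a matrix prescribes for vertices that are numbered for each kind. -/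
def numberedEdges (K : ℕ) (n : Fin 3 → ℕ) (M : Fin 3 → Fin 3 → ℕ) : Set (ℕ × Color K) :=
  {p | p.1 < n p.2.1 ∧ p.2.2.2.val < M p.2.1 p.2.2.1}

/-- For each target `j`, the equation says that two finite sets of edges have equal size. The
bijections for the three targets are glued together; they do not interfere because each preserves
the target. -/
theorem exists_matching {K : ℕ} (hK : 0 < K) {n n' : Fin 3 → ℕ} {M M' : Fin 3 → Fin 3 → ℕ}
    (hM : ∀ i j, M i j ≤ K) (hM' : ∀ i j, M' i j ≤ K)
    (h : ∀ j, ∑ i, M i j * n i = ∑ i, M' i j * n' i) :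
    ∃ ψ : ℕ × Color K → ℕ × Color K,
      Set.BijOn ψ (numberedEdges K n' M') (numberedEdges K n M) ∧
      ∀ p ∈ numberedEdges K n' M', (ψ p).2.2.1 = p.2.2.1 := by
  have : Nonempty (ℕ × Color K) := ⟨(0, 0, 0, ⟨0, hK⟩)⟩
  have fin (m : Fin 3 → ℕ) (i : Fin 3) : (Set.Iio (m i)).Finite := Set.finite_Iio _
  have hex (j : Fin 3) : ∃ f : ℕ × Color K → ℕ × Color K,
      Set.BijOn f (edges K (fun i => Set.Iio (n' i)) M' j) (edges K (fun i => Set.Iio (n i)) M j) := by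
    have f1 := finite_edges hM' (fin n') j
    have f2 := finite_edges hM (fin n) j
    refine f1.exists_bijOn_of_encard_eq ?_
    rw [← f1.cast_ncard_eq, ← f2.cast_ncard_eq, ncard_edges hM' (fin n'), ncard_edges hM (fin n)]
    simp [h j]
  choose f hf using hex
  have htgt : ∀ p ∈ numberedEdges K n' M', f p.2.2.1 p ∈ numberedEdges K n M ∧
      (f p.2.2.1 p).2.2.1 = p.2.2.1 := by
    intro p hp
    have := (hf p.2.2.1).mapsTo (x := p) ⟨hp.1, hp.2, rfl⟩
    exact ⟨⟨this.1, this.2.1⟩, this.2.2⟩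
  refine ⟨fun p => f p.2.2.1 p, ⟨fun p hp => (htgt p hp).1, ?_, ?_⟩, fun p hp => (htgt p hp).2⟩
  · intro p hp p' hp' e
    replace e : f p.2.2.1 p = f p'.2.2.1 p' := e
    have e' : p.2.2.1 = p'.2.2.1 := by rw [← (htgt p hp).2, ← (htgt p' hp').2, e]
    refine (hf p.2.2.1).injOn ⟨hp.1, hp.2, rfl⟩ ⟨hp'.1, hp'.2, e'.symm⟩ ?_
    rw [e, e']
  · intro p hp
    obtain ⟨p', h1, h2⟩ := (hf p.2.2.1).surjOn ⟨hp.1, hp.2, rfl⟩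
    refine ⟨p', ⟨h1.1, h1.2.1⟩, ?_⟩
    dsimp only
    rw [h1.2.2, h2]

namespace CountingSystem

/-- A deterministic transition system that is simulated by a counting system: from the state and
vector of a configuration there is exactly one step, namely to those of the next one. -/
structure Simulation (Y : CountingSystem) (K : ℕ) where
  C : Type
  step : C → Option C
  init : C
  st : C → Y.Q
  vec : C → Fin 3 → ℕ
  Inv : C → Prop
  inv_init : Inv init
  inv_step : ∀ {c c'}, Inv c → step c = some c' → Inv c'
  idx_injective : Function.Injective Y.idx
  mat_le : ∀ b q i j, Y.mat b q i j ≤ K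
  st_init : st init = Y.start
  vec_init : vec init = ![1, 0, 0]
  inn_start : ∀ i j, Y.inn Y.start i j = 0
  out_start : ∀ i j, i ≠ 0 → Y.out Y.start i j = 0
  step_init : step init ≠ none
  st_mem : ∀ {c}, Inv c → st c ∈ Y.states
  next_pos : ∀ {c}, Inv c → ∀ q' ∈ Y.next (st c), q' ∈ Y.states ∧ ∀ i, 0 < Y.inn q' i i
  out_pos : ∀ {c}, Inv c → step c ≠ none → 0 < Y.out (st c) 0 0
  vec_zero : ∀ {c}, Inv c → vec c 0 = 1
  out_final : ∀ {c}, Inv c → step c = none → ∀ i j, Y.out (st c) i j = 0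
  mem_finals : ∀ {c}, Inv c → (st c ∈ Y.finals ↔ step c = none)
  step_next : ∀ {c c'}, Inv c → step c = some c' →
    st c' ∈ Y.next (st c) ∧ Y.Balanced (st c) (st c') (vec c) (vec c')
  step_unique : ∀ {c c'}, Inv c → step c = some c' → ∀ q' ∈ Y.next (st c), ∀ n',
    Y.Balanced (st c) q' (vec c) n' → q' = st c' ∧ n' = vec c'

namespace Simulation

variable {Y : CountingSystem} {K : ℕ} (S : Y.Simulation K)

/-- The sequence of configurations; it becomes constant at a final configuration. -/
def seq : ℕ → S.C
  | 0 => S.init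
  | t + 1 => (S.step (seq t)).getD (seq t)

def Halts : Prop := ∃ t, S.step (S.seq t) = none

/-- The computation has not stopped by time `t`. -/
def Active (t : ℕ) : Prop := S.step (S.seq t) ≠ none

theorem Active.step_eq {S : Y.Simulation K} {t : ℕ} (h : S.Active t) :
    S.step (S.seq t) = some (S.seq (t + 1)) := by
  obtain ⟨c, hc⟩ := Option.ne_none_iff_exists'.1 h
  simp [seq, hc]

theorem inv_seq (t : ℕ) : S.Inv (S.seq t) := by
  induction t with
  | zero => exact S.inv_init
  | succ t ih =>
    by_cases h : S.Active t
    · exact S.inv_step ih h.step_eq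
    · simp only [Active, not_not] at h
      simpa [seq, h] using ih

theorem active_of_succ {t : ℕ} (h : S.Active (t + 1)) : S.Active t := by
  intro h'
  exact h (by simp [seq, h'])

theorem active_of_le {s t : ℕ} (hst : s ≤ t) (h : S.Active t) : S.Active s := by
  induction hst with
  | refl => exact h
  | step _ ih => exact ih (S.active_of_succ h)

section
variable {A : Type} {𝔄 : Str A} {hK : 0 < K} (h : Y.Models hK 𝔄)
include h

theorem exists_represents_succ {x : A} {t : ℕ} (ht : S.Active t)
    (hx : Y.Represents K 𝔄 x (S.st (S.seq t)) (S.vec (S.seq t))) :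
    ∃ y, Y.Represents K 𝔄 y (S.st (S.seq (t + 1))) (S.vec (S.seq (t + 1))) ∧
      Precedes K 𝔄 x y := by
  have hi := S.inv_seq t
  obtain ⟨y, q', hq', n', hb, hy, hp⟩ := h.exists_represents S.mat_le hx (S.st_mem hi)
    (S.next_pos hi) (S.out_pos hi ht) (by simp [S.vec_zero hi])
  obtain ⟨rfl, rfl⟩ := S.step_unique hi ht.step_eq q' hq' n' hb
  exact ⟨y, hy, hp⟩

theorem exists_represents_init :
    ∃ x, Y.Represents K 𝔄 x (S.st (S.seq 0)) (S.vec (S.seq 0)) := by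
  rw [seq, S.st_init, S.vec_init]
  exact h.exists_represents_start (S.st_init ▸ S.st_mem S.inv_init) S.inn_start S.out_start

/-- The model follows the run, and a halting time would produce a point in a forbidden final state.
-/
theorem not_halts_of_models (hf : ∀ q ∈ Y.finals, ∀ x, ¬ 𝔄.pred (2 * Y.idx q + 1) x) :
    ¬ S.Halts := by
  have key : ∀ t, ∃ x, Y.Represents K 𝔄 x (S.st (S.seq t)) (S.vec (S.seq t)) := by
    intro t
    induction t with
    | zero => exact S.exists_represents_init h
    | succ t ih =>
      obtain ⟨x, hx⟩ := ih
      have ht : S.Active t := fun e =>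
        hf _ ((S.mem_finals (S.inv_seq t)).2 e) x hx.1
      obtain ⟨y, hy, -⟩ := S.exists_represents_succ h ht hx
      exact ⟨y, hy⟩
  rintro ⟨t, ht⟩
  obtain ⟨x, hx⟩ := key t
  exact hf _ ((S.mem_finals (S.inv_seq t)).2 ht) x hx.1

theorem halts_of_models [Finite A] : S.Halts := by
  by_contra hh
  have ha : ∀ t, S.Active t := fun t e => hh ⟨t, e⟩
  obtain ⟨x₀, hx₀⟩ := S.exists_represents_init h
  choose! f hf using fun t x => S.exists_represents_succ h (x := x) (ha t)
  let x : ℕ → A := fun t => Nat.rec x₀ (fun t y => f t y) t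
  have hx : ∀ t, Y.Represents K 𝔄 (x t) (S.st (S.seq t)) (S.vec (S.seq t)) := by
    intro t
    induction t with
    | zero => exact hx₀
    | succ t ih => exact (hf t _ ih).1
  have hp : ∀ t, Precedes K 𝔄 (x t) (x (t + 1)) := fun t => (hf t _ (hx t)).2
  -- If two later configurations coincided, so would their predecessors, and so on back to the
  -- initial configuration, which has no predecessor.
  have hne : ∀ i d, ¬ 𝔄.E2.r (x i) (x (i + d + 1)) := by
    intro i d
    induction i with
    | zero =>
      refine h.not_precedes_start (S.st_init ▸ S.st_mem S.inv_init) S.inn_start ?_ (hp _)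
      have := hx₀.1
      rwa [seq, S.st_init] at this
    | succ i ih =>
      intro e
      rw [show i + 1 + d + 1 = (i + d + 1) + 1 by omega] at e
      exact ih (h.rel_of_precedes (hp i) (hp (i + d + 1)) e)
  refine not_injective_infinite_finite x fun i j hij => ?_
  by_contra hne'
  rcases lt_or_gt_of_ne hne' with hlt | hlt
  · obtain ⟨d, rfl⟩ := Nat.exists_eq_add_of_lt hlt
    exact hne i d (hij ▸ 𝔄.E2.refl' _)
  · obtain ⟨d, rfl⟩ := Nat.exists_eq_add_of_lt hlt
    exact hne j d (hij ▸ 𝔄.E2.refl' _)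

end

/-! ### The canonical model of a run. -/

section

/-- The time of the configuration of a point with a given polarity in step `t`. -/
def pos (b : Bool) (t : ℕ) : ℕ := bif b then t else t + 1

/-- The points of the canonical model: an edge of given polarity and colour in step `time`, at the
vertex with number `num`. -/
structure Point where
  pol : Bool
  time : ℕ
  num : ℕ
  col : Color K
  active : S.Active time
  mem : (num, col) ∈ numberedEdges K (S.vec (S.seq (pos pol time)))
    (Y.mat pol (S.st (S.seq (pos pol time))))

variable (ψ : ℕ → ℕ × Color K → ℕ × Color K)

/-- The canonical model for a given matching of incoming with outgoing edges. -/
def canonicalModel : Str S.Point where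
  pred k p := k = colIdx p.pol p.col ∨ k = 2 * Y.idx (S.st (S.seq (pos p.pol p.time))) + 1
  E2 := Setoid.ker fun p => pos p.pol p.time
  E1 := Setoid.ker fun p => (pos p.pol p.time, p.num, p.col.1)
  F2 := Setoid.ker fun p => p.time
  F1 := Setoid.ker fun p =>
    (p.time, bif p.pol then (p.num, p.col) else ψ p.time (p.num, p.col))
  E1_sub_E2 _ _ h := (Prod.ext_iff.1 h).1
  F1_sub_F2 _ _ h := (Prod.ext_iff.1 h).1

variable {S}

theorem canonicalModel_col {b : Bool} {e : Color K} {p : S.Point} :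
    (S.canonicalModel ψ).pred (colIdx b e) p ↔ p.pol = b ∧ p.col = e := by
  have : colIdx b e ≠ 2 * Y.idx (S.st (S.seq (pos p.pol p.time))) + 1 := by
    unfold colIdx; omega
  simp only [canonicalModel, this, or_false, colIdx_inj, eq_comm]

theorem canonicalModel_st {q : Y.Q} {p : S.Point} :
    (S.canonicalModel ψ).pred (2 * Y.idx q + 1) p ↔ S.st (S.seq (pos p.pol p.time)) = q := by
  have : 2 * Y.idx q + 1 ≠ colIdx p.pol p.col := by
    unfold colIdx; omega
  simp only [canonicalModel, this, false_or]
  rw [← S.idx_injective.eq_iff]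
  omega

theorem canonicalModel_E1 {p p' : S.Point} : (S.canonicalModel ψ).E1.r p p' ↔
    pos p.pol p.time = pos p'.pol p'.time ∧ p.num = p'.num ∧ p.col.1 = p'.col.1 := by
  refine Prod.ext_iff.trans (and_congr_right' ?_)
  exact Prod.ext_iff

theorem canonicalModel_E2 {p p' : S.Point} : (S.canonicalModel ψ).E2.r p p' ↔
    pos p.pol p.time = pos p'.pol p'.time := Iff.rfl

theorem canonicalModel_F2 {p p' : S.Point} : (S.canonicalModel ψ).F2.r p p' ↔
    p.time = p'.time := Iff.rfl

theorem canonicalModel_F1 {p p' : S.Point} : (S.canonicalModel ψ).F1.r p p' ↔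
    p.time = p'.time ∧ (bif p.pol then (p.num, p.col) else ψ p.time (p.num, p.col)) =
      (bif p'.pol then (p'.num, p'.col) else ψ p'.time (p'.num, p'.col)) :=
  Prod.ext_iff

theorem models_canonicalModel (hK : 0 < K)
    (hψ : ∀ t, S.Active t →
      Set.BijOn (ψ t)
        (numberedEdges K (S.vec (S.seq (t + 1))) (Y.inn (S.st (S.seq (t + 1)))))
        (numberedEdges K (S.vec (S.seq t)) (Y.out (S.st (S.seq t)))) ∧
      ∀ p ∈ numberedEdges K (S.vec (S.seq (t + 1))) (Y.inn (S.st (S.seq (t + 1)))),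
        (ψ t p).2.2.1 = p.2.2.1) :
    Y.Models hK (S.canonicalModel ψ) where
  pair := by
    rintro b b' e e' ⟨b, t, j, e, ha, hp⟩ ⟨b', t', j', e', ha', hp'⟩ hx hy
    obtain ⟨rfl, rfl⟩ := (canonicalModel_col ψ).1 hx
    obtain ⟨rfl, rfl⟩ := (canonicalModel_col ψ).1 hy
    rw [canonicalModel_E1, canonicalModel_E2, canonicalModel_F1, canonicalModel_F2]
    dsimp only
    refine ⟨?_, ?_, ?_, ?_, fun h1 h2 => h1 h2.2.2⟩
    · rintro rfl
      cases b <;> simp [pos]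
    · rintro ⟨rfl, rfl⟩
      cases b
      · constructor
        · rintro ⟨h1, rfl, -⟩
          obtain rfl : t = t' := by simpa [pos] using h1
          exact ⟨rfl, rfl⟩
        · rintro ⟨rfl, h1⟩
          have := (hψ t ha).1.injOn hp hp' h1
          simp only [Prod.mk.injEq] at this
          exact ⟨rfl, this.1, rfl⟩
      · simp [pos]
    · rintro ⟨rfl, hne⟩ ⟨rfl, h1⟩
      cases b
      · have := (hψ t ha).1.injOn hp hp' h1
        simp only [Prod.mk.injEq] at this
        exact hne this.2
      · simp only [cond_true, Prod.mk.injEq] at h1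
        exact hne h1.2
    · rintro hne ⟨rfl, h1⟩
      apply hne
      have h2 := congrArg (fun p : ℕ × Color K => p.2.2.1) h1
      cases b <;> cases b'
      · simpa [(hψ t ha).2 _ hp, (hψ t ha).2 _ hp'] using h2
      · simpa [(hψ t ha).2 _ hp] using h2
      · simpa [(hψ t ha).2 _ hp'] using h2
      · exact h2
  matched := by
    rintro b e ⟨b, t, j, e, ha, hp⟩ hx
    obtain ⟨rfl, rfl⟩ := (canonicalModel_col ψ).1 hx
    cases b
    · refine ⟨⟨true, t, (ψ t (j, e)).1, (ψ t (j, e)).2, ha, (hψ t ha).1.mapsTo hp⟩, ?_, (ψ t (j, e)).2,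
        (hψ t ha).2 _ hp, ?_⟩
      · exact (canonicalModel_F1 ψ).2 ⟨rfl, rfl⟩
      · exact (canonicalModel_col ψ).2 ⟨rfl, rfl⟩
    · obtain ⟨p, hp', h1⟩ := (hψ t ha).1.surjOn hp
      refine ⟨⟨false, t, p.1, p.2, ha, hp'⟩, (canonicalModel_F1 ψ).2 ⟨rfl, h1.symm⟩, p.2, ?_,
        (canonicalModel_col ψ).2 ⟨rfl, rfl⟩⟩
      rw [← (hψ t ha).2 _ hp', h1]
  spread := by
    intro q _ x y hx hxy
    rw [canonicalModel_st] at hx ⊢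
    rw [← hx, (canonicalModel_E2 ψ).1 hxy]
  degree := by
    rintro q _ b e b₀ e₀ he hlt ⟨b₀, t, j, e₀, ha, hp⟩ hq hx
    obtain ⟨rfl, rfl⟩ := (canonicalModel_col ψ).1 hx
    obtain rfl := (canonicalModel_st ψ).1 hq
    dsimp only at ha hp he hlt ⊢
    -- The required edge belongs to step `t'`: incoming edges to the step before the configuration,
    -- outgoing ones to the step after it. Where that step is missing, at the start or after
    -- halting, the matrix is zero and nothing is required.
    obtain ⟨t', ht', ha'⟩ : ∃ t', pos b t' = pos b₀ t ∧ S.Active t' := by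
      cases b
      · cases b₀
        · exact ⟨t, rfl, ha⟩
        · cases t with
          | zero => simp [pos, seq, S.st_init, S.inn_start] at hlt
          | succ t => exact ⟨t, rfl, S.active_of_succ ha⟩
      · refine ⟨pos b₀ t, rfl, fun h0 => ?_⟩
        simp [S.out_final (S.inv_seq _) h0] at hlt
    refine ⟨⟨b, t', j, e, ha', ?_⟩, (canonicalModel_E1 ψ).2 ⟨ht'.symm, rfl, he⟩,
      (canonicalModel_col ψ).2 ⟨rfl, rfl⟩⟩
    rw [ht']
    exact ⟨he ▸ hp.1, hlt⟩
  degree_lt := by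
    rintro q _ b e ⟨b, t, j, e, ha, hp⟩ hq hx
    obtain ⟨rfl, rfl⟩ := (canonicalModel_col ψ).1 hx
    obtain rfl := (canonicalModel_st ψ).1 hq
    exact hp.2
  next := by
    rintro q _ e e' ⟨b, t, j, e, ha, hp⟩ ⟨b', t', j', e', ha', hp'⟩ hq hx hy hxy
    obtain ⟨rfl, rfl⟩ := (canonicalModel_col ψ).1 hx
    obtain ⟨rfl, rfl⟩ := (canonicalModel_col ψ).1 hy
    obtain rfl := (canonicalModel_st ψ).1 hq
    obtain rfl : t = t' := (canonicalModel_F2 ψ).1 hxy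
    exact ⟨_, (S.step_next (S.inv_seq t) ha.step_eq).1, (canonicalModel_st ψ).2 rfl⟩
  start := by
    refine ⟨⟨true, 0, 0, (0, 0, ⟨0, hK⟩), S.step_init, ?_, ?_⟩, (canonicalModel_st ψ).2 S.st_init,
      (canonicalModel_col ψ).2 ⟨rfl, rfl⟩⟩
    · simp [pos, S.vec_zero (S.inv_seq _)]
    · exact S.out_pos S.inv_init S.step_init
  start_unique := by
    have key : ∀ p : S.Point, (S.canonicalModel ψ).pred (2 * Y.idx Y.start + 1) p →
        p.col.1 = 0 ∧ p.num = 0 := by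
      rintro ⟨b, t, j, e, ha, hp⟩ hq
      have hq' := (canonicalModel_st ψ).1 hq
      dsimp only at hp hq' ⊢
      have h2 := hp.2
      have h1 := hp.1
      rw [hq'] at h2
      have he : e.1 = 0 := by
        by_contra hne
        cases b
        · simp [S.inn_start] at h2
        · simp [S.out_start _ _ hne] at h2
      refine ⟨he, ?_⟩
      simp only [he, S.vec_zero (S.inv_seq _)] at h1
      omega
    intro x y hx hy hxy
    obtain ⟨h1, h2⟩ := key x hx
    obtain ⟨h3, h4⟩ := key y hy
    exact (canonicalModel_E1 ψ).2 ⟨(canonicalModel_E2 ψ).1 hxy, h2.trans h4.symm, h1.trans h3.symm⟩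

end

theorem exists_models (hK : 0 < K) : ∃ ψ, Y.Models hK (S.canonicalModel ψ) := by
  have : ∀ t, ∃ ψ : ℕ × Color K → ℕ × Color K, S.Active t →
      Set.BijOn ψ
        (numberedEdges K (S.vec (S.seq (t + 1))) (Y.inn (S.st (S.seq (t + 1)))))
        (numberedEdges K (S.vec (S.seq t)) (Y.out (S.st (S.seq t)))) ∧
      ∀ p ∈ numberedEdges K (S.vec (S.seq (t + 1))) (Y.inn (S.st (S.seq (t + 1)))),
        (ψ p).2.2.1 = p.2.2.1 := by
    intro t
    by_cases ht : S.Active t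
    · obtain ⟨ψ, h⟩ := exists_matching hK (S.mat_le true _) (S.mat_le false _)
        (S.step_next (S.inv_seq t) ht.step_eq).2
      exact ⟨ψ, fun _ => h⟩
    · exact ⟨id, fun h => absurd h ht⟩
  choose ψ hψ using this
  exact ⟨ψ, models_canonicalModel ψ hK hψ⟩

/-- Only active steps have points, so a halting time bounds `time`, and each step contributes
finitely many edges. -/
theorem finite_point (h : S.Halts) : Finite S.Point := by
  obtain ⟨T, hT⟩ := h
  have hfin : (⋃ b : Bool, ⋃ t ∈ Set.Iio T, ⋃ i : Fin 3,
      ({b} ×ˢ {t} ×ˢ Set.Iio (S.vec (S.seq (pos b t)) i) ×ˢ Set.univ :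
        Set (Bool × ℕ × ℕ × Color K))).Finite := by
    refine Set.finite_iUnion fun b => (Set.finite_Iio T).biUnion fun t _ => Set.finite_iUnion fun i =>
      (Set.finite_singleton _).prod ((Set.finite_singleton _).prod
        ((Set.finite_Iio _).prod Set.finite_univ))
  let f : S.Point → Bool × ℕ × ℕ × Color K := fun p => (p.pol, p.time, p.num, p.col)
  have hf : Function.Injective f := by
    rintro ⟨b, t, j, e, _, _⟩ ⟨b', t', j', e', _, _⟩ h
    simp only [f, Prod.mk.injEq] at h
    obtain ⟨rfl, rfl, rfl, rfl⟩ := h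
    rfl
  refine Set.finite_univ_iff.1 (Set.Finite.of_finite_image (hfin.subset ?_) hf.injOn (f := f))
  rintro _ ⟨⟨b, t, j, e, ha, hp⟩, -, rfl⟩
  simp only [Set.mem_iUnion]
  refine ⟨b, t, ?_, e.1, rfl, rfl, hp.1, trivial⟩
  by_contra hlt
  exact S.active_of_le (not_lt.1 hlt) ha hT

theorem finitelySatisfiable_iff (hK : 0 < K) :
    FinitelySatisfiable (Y.runSentence hK) ↔ S.Halts := by
  constructor
  · rintro ⟨A, _, _, 𝔄, h⟩
    exact S.halts_of_models ((isModel_runSentence 𝔄 Y hK).1 h)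
  · intro hh
    obtain ⟨ψ, h⟩ := S.exists_models hK
    have hne : Nonempty S.Point := ⟨h.start.choose⟩
    exact ⟨S.Point, hne, S.finite_point hh, _, (isModel_runSentence _ Y hK).2 h⟩

theorem satisfiable_iff (hK : 0 < K) :
    Satisfiable (Y.infiniteRunSentence hK) ↔ ¬ S.Halts := by
  constructor
  · rintro ⟨A, _, 𝔄, h⟩
    have := (isModel_infiniteRunSentence 𝔄 Y hK).1 h
    exact S.not_halts_of_models this.1 this.2
  · intro hh
    obtain ⟨ψ, h⟩ := S.exists_models hK
    have hne : Nonempty S.Point := ⟨h.start.choose⟩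
    refine ⟨S.Point, hne, _, (isModel_infiniteRunSentence _ Y hK).2 ⟨h, fun q hq p hp => hh ?_⟩⟩
    obtain rfl := (canonicalModel_st ψ).1 hp
    exact ⟨_, (S.mem_finals (S.inv_seq _)).1 hq⟩

end Simulation

end CountingSystem

/-! ### Turing machines as counting systems. -/

open Turing

/-- Reading the symbols of a half tape as digits. -/
def halfTapeValue {Γ : Type} [Inhabited Γ] (dg : Γ → ℕ) (h0 : dg default = 0) (k : ℕ)
    (l : ListBlank Γ) : ℕ :=
  l.liftOn (fun l => l.foldr (fun a n => dg a + k * n) 0) (by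
    rintro l _ ⟨n, rfl⟩
    have : (List.replicate n (default : Γ)).foldr (fun a n => dg a + k * n) 0 = 0 := by
      induction n with
      | zero => rfl
      | succ n ih => simp [List.replicate_succ, ih, h0]
    rw [List.foldr_append, this])

theorem halfTapeValue_cons {Γ : Type} [Inhabited Γ] (dg : Γ → ℕ) (h0 : dg default = 0) (k : ℕ)
    (a : Γ) (l : ListBlank Γ) :
    halfTapeValue dg h0 k (l.cons a) = dg a + k * halfTapeValue dg h0 k l := by
  induction l using ListBlank.induction_on
  rfl

/-- The cell next to the head is the least significant digit, so a move is one multiplication or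
division by the base. -/
theorem halfTapeValue_head_tail {Γ : Type} [Inhabited Γ] (dg : Γ → ℕ) (h0 : dg default = 0) (k : ℕ)
    (l : ListBlank Γ) :
    halfTapeValue dg h0 k l = dg l.head + k * halfTapeValue dg h0 k l.tail := by
  rw [← halfTapeValue_cons, ListBlank.cons_head_tail]

def idMat (i j : Fin 3) : ℕ := if i = j then 1 else 0

/-- The matrix of the affine map that appends a digit to component `c`. -/
def pushMat (k : ℕ) (c : Fin 3) (a : ℕ) (i j : Fin 3) : ℕ :=
  if i = j then (if i = c then k else 1) else if i = 0 ∧ j = c then a else 0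

theorem sum_idMat (n : Fin 3 → ℕ) (j : Fin 3) : ∑ i, idMat i j * n i = n j := by
  simp [idMat]

theorem sum_pushMat (k : ℕ) {c : Fin 3} (hc : c ≠ 0) (a : ℕ) (n : Fin 3 → ℕ) (j : Fin 3) :
    ∑ i, pushMat k c a i j * n i = if j = c then a * n 0 + k * n c else n j := by
  fin_cases c <;> fin_cases j <;> simp_all [pushMat, Fin.sum_univ_three]

/-- The component of the configuration vector that holds a half tape. -/
def side : Dir → Fin 3
  | .left => 1
  | .right => 2

def opposite : Dir → Dir
  | .left => .right
  | .right => .left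

theorem side_ne_zero (d : Dir) : side d ≠ 0 := by cases d <;> decide

/-- The states of the counting system of a Turing machine. A running state records the scanned
symbol and the last move. -/
inductive TMState (Γ Λ : Type) : Type
  | start : TMState Γ Λ
  | load : ℕ → TMState Γ Λ
  | run : Λ → Γ → Option Dir → TMState Γ Λ

/-- The configurations of the simulated computation: first the input is written. -/
inductive TMConfig (Γ Λ : Type) [Inhabited Γ] : Type
  | start : TMConfig Γ Λ
  | load : ℕ → ℕ → TMConfig Γ Λ
  | run : Option Dir → TM0.Cfg Γ Λ → TMConfig Γ Λ

/-- A Turing machine with finitely many states and symbols, with a numbering of the symbols and of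
the running states. -/
structure FiniteTM where
  Γ : Type
  Λ : Type
  instΓ : Inhabited Γ
  instΛ : Inhabited Λ
  M : Λ → Γ → Option (Λ × TM0.Stmt Γ)
  base : ℕ
  dg : Γ → ℕ
  dg_default : dg default = 0
  dg_injective : Function.Injective dg
  dg_lt : ∀ a, dg a < base
  num : ℕ
  label : Λ × Γ × Option Dir → ℕ
  label_injective : Function.Injective label
  label_lt : ∀ t, label t < num
  symbols : List Γ
  mem_symbols : ∀ a, a ∈ symbols
  labels : List (Λ × Γ × Option Dir)
  mem_labels : ∀ t, t ∈ labels
  first : Γ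
  fill : Γ

namespace FiniteTM

variable (T : FiniteTM)

instance : Inhabited T.Γ := T.instΓ
instance : Inhabited T.Λ := T.instΛ

abbrev machine : TM0.Machine T.Γ T.Λ := T.M

def tape (m : ℕ) : List T.Γ := T.first :: List.replicate m T.fill

/-- A move in direction `d` leaves the scanned symbol on the opposite side, and loading adds one
`fill` to the right half tape. The zero matrix of a halting state frees it from having a successor.
-/
def outMat : TMState T.Γ T.Λ → Fin 3 → Fin 3 → ℕ
  | .start => fun i j => if i = 0 ∧ j = 0 then 1 else 0
  | .load 0 => idMat
  | .load (_ + 1) => pushMat T.base 2 (T.dg T.fill)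
  | .run q a _ => match T.M q a with
    | none => fun _ _ => 0
    | some (_, .move d) => pushMat T.base (side (opposite d)) (T.dg a)
    | some (_, .write _) => idMat

/-- After a move in direction `d`, pushing the newly scanned symbol back on side `d` must recover
the old half tape. The recorded direction is therefore part of the state. -/
def innMat : TMState T.Γ T.Λ → Fin 3 → Fin 3 → ℕ
  | .start => fun _ _ => 0
  | .load _ => idMat
  | .run _ _ none => idMat
  | .run _ a (some d) => pushMat T.base (side d) (T.dg a)

/-- A move offers every symbol as the one scanned next; the equations select the right one. -/
def nextStates (m : ℕ) : TMState T.Γ T.Λ → List (TMState T.Γ T.Λ)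
  | .start => [.load m]
  | .load 0 => [.run default T.first none]
  | .load (j + 1) => [.load j]
  | .run q a _ => match T.M q a with
    | none => []
    | some (q', .move d) => T.symbols.map fun b => .run q' b (some d)
    | some (q', .write b) => [.run q' b none]

/-- Loading states are numbered last: only their number grows with the input. -/
def index : TMState T.Γ T.Λ → ℕ
  | .start => 0
  | .load j => 1 + T.num + j
  | .run q a d => 1 + T.label (q, a, d)

def states (m : ℕ) : List (TMState T.Γ T.Λ) :=
  .start :: .load 0 :: (T.labels.map (fun t => .run t.1 t.2.1 t.2.2) ++
    (List.range m).map fun j => .load (j + 1))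

def finals : List (TMState T.Γ T.Λ) :=
  (T.labels.filter fun t => (T.M t.1 t.2.1).isNone).map fun t => .run t.1 t.2.1 t.2.2

/-- The counting system that simulates the machine on the input `tape m`. -/
def system (m : ℕ) : CountingSystem where
  Q := TMState T.Γ T.Λ
  mat b q := if b then T.outMat q else T.innMat q
  next := T.nextStates m
  idx := T.index
  start := .start
  states := T.states m
  finals := T.finals

abbrev value (l : ListBlank T.Γ) : ℕ := halfTapeValue T.dg T.dg_default T.base l

def step (m : ℕ) : TMConfig T.Γ T.Λ → Option (TMConfig T.Γ T.Λ)
  | .start => some (.load 0 m)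
  | .load i 0 => some (.run none (TM0.init (T.tape i)))
  | .load i (j + 1) => some (.load (i + 1) j)
  | .run _ c => match T.M c.q c.Tape.head with
    | none => none
    | some (q', .move d) => some (.run (some d) ⟨q', c.Tape.move d⟩)
    | some (q', .write b) => some (.run none ⟨q', c.Tape.write b⟩)

def stateOf : TMConfig T.Γ T.Λ → TMState T.Γ T.Λ
  | .start => .start
  | .load _ j => .load j
  | .run d c => .run c.q c.Tape.head d

def vecOf : TMConfig T.Γ T.Λ → Fin 3 → ℕ
  | .start => ![1, 0, 0]
  | .load i _ => ![1, 0, T.value (ListBlank.mk (List.replicate i T.fill))]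
  | .run _ c => ![1, T.value c.Tape.left, T.value c.Tape.right]

/-- In `load i j`, `i` symbols have been written and `j` remain, so no loading state beyond `m`
occurs. -/
def Inv (m : ℕ) : TMConfig T.Γ T.Λ → Prop
  | .load i j => i + j = m
  | _ => True

theorem vecOf_zero (c : TMConfig T.Γ T.Λ) : T.vecOf c 0 = 1 := by
  cases c <;> rfl

theorem base_pos : 0 < T.base := (Nat.zero_le _).trans_lt (T.dg_lt default)

theorem pushMat_le (c : Fin 3) (a : T.Γ) (i j : Fin 3) : pushMat T.base c (T.dg a) i j ≤ T.base := by
  have h1 := T.dg_lt a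
  have h2 := T.base_pos
  unfold pushMat
  split_ifs <;> omega

theorem idMat_le (i j : Fin 3) : idMat i j ≤ T.base := by
  have h2 := T.base_pos
  unfold idMat
  split_ifs <;> omega

theorem outMat_le (q : TMState T.Γ T.Λ) (i j : Fin 3) : T.outMat q i j ≤ T.base := by
  unfold outMat
  split
  · have := T.base_pos
    split_ifs <;> omega
  · exact T.idMat_le i j
  · exact T.pushMat_le _ _ i j
  · rename_i q a d
    rcases h : T.M q a with _ | ⟨q', d | b⟩
    · exact Nat.zero_le _
    · exact T.pushMat_le _ _ i j
    · exact T.idMat_le i j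

theorem innMat_le (q : TMState T.Γ T.Λ) (i j : Fin 3) : T.innMat q i j ≤ T.base := by
  unfold innMat
  split
  · exact Nat.zero_le _
  · exact T.idMat_le i j
  · exact T.idMat_le i j
  · exact T.pushMat_le _ _ i j

theorem idMat_self (i : Fin 3) : 0 < idMat i i := by simp [idMat]

theorem pushMat_self (c : Fin 3) (a : ℕ) (i : Fin 3) : 0 < pushMat T.base c a i i := by
  have := T.base_pos
  simp only [pushMat, if_true]
  split_ifs <;> omega

theorem innMat_self {q : TMState T.Γ T.Λ} (hq : q ≠ .start) (i : Fin 3) : 0 < T.innMat q i i := by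
  unfold innMat
  split
  · exact absurd rfl hq
  · exact idMat_self i
  · exact idMat_self i
  · exact T.pushMat_self _ _ i

theorem index_injective : Function.Injective T.index := by
  intro q q' h
  cases q with
  | start => cases q' <;> simp only [index] at h ⊢ <;> omega
  | load j =>
    cases q' with
    | start => simp only [index] at h; omega
    | load j' => simpa [index] using h
    | run q' a' d' =>
      have := T.label_lt (q', a', d')
      simp only [index] at h
      omega
  | run q a d =>
    have := T.label_lt (q, a, d)
    cases q' with
    | start => simp only [index] at h; omega
    | load j' => simp only [index] at h; omega
    | run q' a' d' =>
      simpa using T.label_injective (Nat.add_left_cancel h)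

/-- Quotient and remainder by the base are unique. This is what makes the guess of the next symbol
deterministic. -/
theorem digit_unique {a b : T.Γ} {x y : ℕ} (h : T.dg a + T.base * x = T.dg b + T.base * y) :
    a = b ∧ x = y := by
  have h1 := congrArg (· % T.base) h
  simp only [Nat.add_mul_mod_self_left, Nat.mod_eq_of_lt (T.dg_lt _)] at h1
  refine ⟨T.dg_injective h1, ?_⟩
  rw [h1] at h
  exact Nat.eq_of_mul_eq_mul_left T.base_pos (Nat.add_left_cancel h)

theorem mem_states_run (m : ℕ) (q : T.Λ) (a : T.Γ) (d : Option Dir) :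
    TMState.run q a d ∈ T.states m := by
  simp only [states, List.mem_cons, List.mem_append, List.mem_map]
  exact .inr (.inr (.inl ⟨(q, a, d), T.mem_labels _, rfl⟩))

theorem mem_states_load {m j : ℕ} (h : j ≤ m) : TMState.load j ∈ T.states m := by
  simp only [states, List.mem_cons, List.mem_append, List.mem_map, List.mem_range]
  cases j with
  | zero => exact .inr (.inl rfl)
  | succ j => exact .inr (.inr (.inr ⟨j, h, rfl⟩))

theorem out_system (m : ℕ) (q : TMState T.Γ T.Λ) : (T.system m).out q = T.outMat q := rfl
theorem inn_system (m : ℕ) (q : TMState T.Γ T.Λ) : (T.system m).inn q = T.innMat q := rfl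

theorem mem_nextStates {m : ℕ} {c : TMConfig T.Γ T.Λ} (hc : T.Inv m c) {q : TMState T.Γ T.Λ}
    (hq : q ∈ T.nextStates m (T.stateOf c)) : q ∈ T.states m ∧ q ≠ .start := by
  cases c with
  | start =>
    obtain rfl : q = .load m := by simpa [nextStates, stateOf] using hq
    exact ⟨T.mem_states_load le_rfl, by simp⟩
  | load i j =>
    cases j with
    | zero =>
      obtain rfl : q = .run default T.first none := by simpa [nextStates, stateOf] using hq
      exact ⟨T.mem_states_run _ _ _ _, by simp⟩
    | succ j =>
      obtain rfl : q = .load j := by simpa [nextStates, stateOf] using hq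
      simp only [Inv] at hc
      exact ⟨T.mem_states_load (by omega), by simp⟩
  | run d c =>
    simp only [nextStates, stateOf] at hq
    split at hq
    · simp at hq
    · obtain ⟨b, -, rfl⟩ := List.mem_map.1 hq
      exact ⟨T.mem_states_run _ _ _ _, by simp⟩
    · obtain rfl := List.mem_singleton.1 hq
      exact ⟨T.mem_states_run _ _ _ _, by simp⟩

theorem stateOf_mem {m : ℕ} {c : TMConfig T.Γ T.Λ} (hc : T.Inv m c) :
    T.stateOf c ∈ T.states m := by
  cases c with
  | start => simp [states, stateOf]
  | load i j => exact T.mem_states_load (by simp only [Inv] at hc; omega)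
  | run d c => exact T.mem_states_run _ _ _ _

theorem step_eq_none_iff {m : ℕ} {c : TMConfig T.Γ T.Λ} :
    T.step m c = none ↔ T.stateOf c ∈ T.finals := by
  cases c with
  | start => simp [step, stateOf, finals]
  | load i j => cases j <;> simp [step, stateOf, finals]
  | run d c =>
    have : T.step m (.run d c) = none ↔ T.M c.q c.Tape.head = none := by
      rcases h : T.M c.q c.Tape.head with _ | ⟨q', e | b⟩ <;> simp [step, h]
    rw [this]
    simp only [finals, stateOf, List.mem_map, List.mem_filter, T.mem_labels, true_and,
      Option.isNone_iff_eq_none]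
    constructor
    · exact fun h => ⟨(c.q, c.Tape.head, d), h, rfl⟩
    · rintro ⟨⟨q, a, d'⟩, h, e⟩
      injection e with h1 h2 h3
      subst h1 h2
      exact h

theorem outMat_final {m : ℕ} {c : TMConfig T.Γ T.Λ} (h : T.step m c = none) (i j : Fin 3) :
    T.outMat (T.stateOf c) i j = 0 := by
  cases c with
  | start => simp [step] at h
  | load i j => cases j <;> simp [step] at h
  | run d c =>
    rcases h' : T.M c.q c.Tape.head with _ | ⟨q', e | b⟩ <;> simp [step, h'] at h
    simp [outMat, stateOf, h']

theorem outMat_pos {m : ℕ} {c : TMConfig T.Γ T.Λ} (h : T.step m c ≠ none) :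
    0 < T.outMat (T.stateOf c) 0 0 := by
  cases c with
  | start => simp [outMat, stateOf]
  | load i j =>
    cases j
    · exact idMat_self 0
    · exact T.pushMat_self _ _ 0
  | run d c =>
    rcases h' : T.M c.q c.Tape.head with _ | ⟨q', e | b⟩
    · simp [step, h'] at h
    · simpa only [outMat, stateOf, h'] using T.pushMat_self _ _ 0
    · simpa only [outMat, stateOf, h'] using idMat_self 0

/-- The step equation for a transition that leaves the vector unchanged. -/
theorem balanced_id_iff {m : ℕ} {q q' : TMState T.Γ T.Λ} (h : T.outMat q = idMat)
    (h' : T.innMat q' = idMat) (n n' : Fin 3 → ℕ) :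
    (T.system m).Balanced q q' n n' ↔ n' = n := by
  simp only [CountingSystem.Balanced, out_system, inn_system, h, h', sum_idMat, funext_iff,
    eq_comm]

theorem balanced_move_iff {m : ℕ} {q q' : TMState T.Γ T.Λ} {d : Dir} {a b : ℕ}
    (h : T.outMat q = pushMat T.base (side (opposite d)) a)
    (h' : T.innMat q' = pushMat T.base (side d) b) (n n' : Fin 3 → ℕ) (h0 : n 0 = 1) :
    (T.system m).Balanced q q' n n' ↔ n' 0 = 1 ∧
      n' (side (opposite d)) = a + T.base * n (side (opposite d)) ∧
      n (side d) = b + T.base * n' (side d) := by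
  simp only [CountingSystem.Balanced, out_system, inn_system, h, h',
    sum_pushMat _ (side_ne_zero _), Fin.forall_fin_succ, Fin.forall_fin_zero]
  cases d <;> simp [side, opposite, h0] <;> grind

theorem balanced_start_iff {m : ℕ} {n n' : Fin 3 → ℕ} {q' : TMState T.Γ T.Λ}
    (h' : T.innMat q' = idMat) (h0 : n 0 = 1) :
    (T.system m).Balanced .start q' n n' ↔ n' = ![1, 0, 0] := by
  simp only [CountingSystem.Balanced, out_system, inn_system, h', funext_iff,
    Fin.forall_fin_succ, outMat, Fin.sum_univ_three]
  simp [idMat, h0, eq_comm]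

theorem balanced_load_iff {m j : ℕ} {n n' : Fin 3 → ℕ} {q' : TMState T.Γ T.Λ}
    (h' : T.innMat q' = idMat) :
    (T.system m).Balanced (.load (j + 1)) q' n n' ↔
      n' = ![n 0, n 1, T.dg T.fill * n 0 + T.base * n 2] := by
  simp only [CountingSystem.Balanced, out_system, inn_system, h', sum_idMat, funext_iff,
    Fin.forall_fin_succ, outMat, sum_pushMat T.base (show (2 : Fin 3) ≠ 0 by decide)]
  simp [eq_comm (a := n' _)]

theorem vecOf_move (d d' : Option Dir) (q q' : T.Λ) (t : Tape T.Γ) (e : Dir) :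
    T.vecOf (.run d' ⟨q', t.move e⟩) (side (opposite e)) =
        T.dg t.head + T.base * T.vecOf (.run d ⟨q, t⟩) (side (opposite e)) ∧
      T.vecOf (.run d ⟨q, t⟩) (side e) =
        T.dg (t.move e).head + T.base * T.vecOf (.run d' ⟨q', t.move e⟩) (side e) := by
  cases e
  · exact ⟨halfTapeValue_cons T.dg T.dg_default _ _ _, halfTapeValue_head_tail T.dg T.dg_default _ _⟩
  · exact ⟨halfTapeValue_cons T.dg T.dg_default _ _ _, halfTapeValue_head_tail T.dg T.dg_default _ _⟩

theorem step_next {m : ℕ} {c c' : TMConfig T.Γ T.Λ} (h : T.step m c = some c') :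
    T.stateOf c' ∈ T.nextStates m (T.stateOf c) ∧
      (T.system m).Balanced (T.stateOf c) (T.stateOf c') (T.vecOf c) (T.vecOf c') := by
  cases c with
  | start =>
    obtain rfl : .load 0 m = c' := by simpa [step] using h
    exact ⟨List.mem_singleton_self _, (T.balanced_start_iff rfl rfl).2 rfl⟩
  | load i j =>
    cases j with
    | zero =>
      obtain rfl : .run none (TM0.init (T.tape i)) = c' := by simpa [step] using h
      exact ⟨List.mem_singleton_self _, (T.balanced_id_iff rfl rfl _ _).2 rfl⟩
    | succ j =>
      obtain rfl : .load (i + 1) j = c' := by simpa [step] using h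
      refine ⟨List.mem_singleton_self _, (T.balanced_load_iff rfl).2 ?_⟩
      simp only [vecOf, List.replicate_succ, ← ListBlank.cons_mk, value, halfTapeValue_cons]
      simp
  | run d c =>
    obtain ⟨q, t⟩ := c
    rcases h' : T.M q t.head with _ | ⟨q', e | b⟩
    · simp [step, h'] at h
    · obtain rfl : .run (some e) ⟨q', t.move e⟩ = c' := by simpa [step, h'] using h
      refine ⟨?_, (T.balanced_move_iff (by simp only [stateOf, outMat, h']) rfl _ _ rfl).2
        ⟨rfl, T.vecOf_move _ _ _ _ _ _⟩⟩
      simp only [nextStates, stateOf, h']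
      exact List.mem_map_of_mem (T.mem_symbols _)
    · obtain rfl : .run none ⟨q', t.write b⟩ = c' := by simpa [step, h'] using h
      refine ⟨?_, (T.balanced_id_iff (by simp only [stateOf, outMat, h']) rfl _ _).2 rfl⟩
      simp only [nextStates, stateOf, h']
      exact List.mem_singleton_self _

/-- For a move, the guessed and the true symbol are both the last digit of the same number, so they
agree and so do the remaining digits. All other transitions offer one state, and their equations
determine the vector. -/
theorem step_unique {m : ℕ} {c c' : TMConfig T.Γ T.Λ} (h : T.step m c = some c')
    {q' : TMState T.Γ T.Λ} (hq : q' ∈ T.nextStates m (T.stateOf c)) {n' : Fin 3 → ℕ}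
    (hb : (T.system m).Balanced (T.stateOf c) q' (T.vecOf c) n') :
    q' = T.stateOf c' ∧ n' = T.vecOf c' := by
  have hb' := (T.step_next h).2
  cases c with
  | start =>
    obtain rfl : .load 0 m = c' := by simpa [step] using h
    obtain rfl := List.mem_singleton.1 hq
    exact ⟨rfl, (T.balanced_start_iff rfl rfl).1 hb⟩
  | load i j =>
    cases j with
    | zero =>
      obtain rfl : .run none (TM0.init (T.tape i)) = c' := by simpa [step] using h
      obtain rfl := List.mem_singleton.1 hq
      exact ⟨rfl, (T.balanced_id_iff rfl rfl _ _).1 hb⟩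
    | succ j =>
      obtain rfl : .load (i + 1) j = c' := by simpa [step] using h
      obtain rfl := List.mem_singleton.1 hq
      exact ⟨rfl, ((T.balanced_load_iff rfl).1 hb).trans ((T.balanced_load_iff rfl).1 hb').symm⟩
  | run d c =>
    obtain ⟨q, t⟩ := c
    rcases h' : T.M q t.head with _ | ⟨q', e | b⟩
    · simp [step, h'] at h
    · obtain rfl : .run (some e) ⟨q', t.move e⟩ = c' := by simpa [step, h'] using h
      simp only [nextStates, stateOf, h'] at hq
      obtain ⟨b, -, rfl⟩ := List.mem_map.1 hq
      have ho : T.outMat (T.stateOf (.run d ⟨q, t⟩)) =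
          pushMat T.base (side (opposite e)) (T.dg t.head) := by
        simp only [stateOf, outMat, h']
      obtain ⟨h1, h2, h3⟩ := (T.balanced_move_iff ho rfl _ _ rfl).1 hb
      obtain ⟨h4, h5, h6⟩ := (T.balanced_move_iff ho rfl _ _ rfl).1 hb'
      obtain ⟨rfl, h7⟩ := T.digit_unique (h3.symm.trans h6)
      refine ⟨rfl, funext fun i => ?_⟩
      have hi : i = 0 ∨ i = side (opposite e) ∨ i = side e := by
        cases e <;> fin_cases i <;> simp [side, opposite]
      obtain rfl | rfl | rfl := hi
      · exact h1.trans h4.symm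
      · exact h2.trans h5.symm
      · exact h7
    · obtain rfl : .run none ⟨q', t.write b⟩ = c' := by simpa [step, h'] using h
      simp only [nextStates, stateOf, h'] at hq
      obtain rfl := List.mem_singleton.1 hq
      have ho : T.outMat (T.stateOf (.run d ⟨q, t⟩)) = idMat := by
        simp only [stateOf, outMat, h']
      exact ⟨rfl, (T.balanced_id_iff ho rfl _ _).1 hb⟩

theorem inv_step {m : ℕ} {c c' : TMConfig T.Γ T.Λ} (hc : T.Inv m c) (h : T.step m c = some c') :
    T.Inv m c' := by
  cases c with
  | start =>
    obtain rfl : .load 0 m = c' := by simpa [step] using h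
    exact Nat.zero_add m
  | load i j =>
    cases j with
    | zero =>
      obtain rfl : .run none (TM0.init (T.tape i)) = c' := by simpa [step] using h
      trivial
    | succ j =>
      obtain rfl : .load (i + 1) j = c' := by simpa [step] using h
      simp only [Inv] at hc ⊢
      omega
  | run d c =>
    rcases h' : T.M c.q c.Tape.head with _ | ⟨q', e | b⟩ <;> simp [step, h'] at h <;> subst h <;>
      trivial

/-- The system simulates the machine. -/
def simulation (m : ℕ) : (T.system m).Simulation T.base where
  C := TMConfig T.Γ T.Λ
  step := T.step m
  init := .start
  st := T.stateOf
  vec := T.vecOf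
  Inv := T.Inv m
  inv_init := trivial
  inv_step := T.inv_step
  idx_injective := T.index_injective
  mat_le b q i j := by
    cases b
    · exact T.innMat_le q i j
    · exact T.outMat_le q i j
  st_init := rfl
  vec_init := rfl
  inn_start _ _ := rfl
  out_start i j h := if_neg fun h' => h h'.1
  step_init := by simp [step]
  st_mem := T.stateOf_mem
  next_pos hc q' hq' := ⟨(T.mem_nextStates hc hq').1, T.innMat_self (T.mem_nextStates hc hq').2⟩
  out_pos _ h := T.outMat_pos h
  vec_zero _ := T.vecOf_zero _
  out_final _ h := T.outMat_final h
  mem_finals _ := T.step_eq_none_iff.symm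
  step_next _ h := T.step_next h
  step_unique _ h _ hq _ hb := T.step_unique h hq hb

end FiniteTM

theorem CountingSystem.Simulation.halts_iff {Y : CountingSystem} {K : ℕ} (S : Y.Simulation K) :
    S.Halts ↔ (StateTransition.eval S.step S.init).Dom := by
  rw [Part.dom_iff_mem]
  simp only [StateTransition.mem_eval]
  constructor
  · rintro ⟨t, ht⟩
    refine ⟨S.seq t, ?_, ht⟩
    clear ht
    induction t with
    | zero => exact .refl
    | succ t ih =>
      by_cases h : S.Active t
      · exact ih.tail h.step_eq
      · simp only [Active, not_not] at h
        simpa [seq, h] using ih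
  · rintro ⟨c, hc, hn⟩
    suffices ∃ t, S.seq t = c by
      obtain ⟨t, rfl⟩ := this
      exact ⟨t, hn⟩
    clear hn
    induction hc with
    | refl => exact ⟨0, rfl⟩
    | tail _ h ih =>
      obtain ⟨t, rfl⟩ := ih
      refine ⟨t + 1, ?_⟩
      rw [Option.mem_def] at h
      simp [seq, h]

/-! ### Correctness and computability of the reduction. -/

namespace FiniteTM

variable (T : FiniteTM)

theorem eval_load (m i j : ℕ) : StateTransition.eval (T.step m) (.load i j) =
    StateTransition.eval (T.step m) (.run none (TM0.init (T.tape (i + j)))) := by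
  induction j generalizing i with
  | zero => exact StateTransition.reaches_eval (.single rfl)
  | succ j ih =>
    rw [StateTransition.reaches_eval (f := T.step m) (b := .load (i + 1) j) (.single rfl), ih,
      Nat.add_right_comm, Nat.add_assoc]

theorem simulation_halts_iff (m : ℕ) :
    (T.simulation m).Halts ↔ (TM0.eval T.machine (T.tape m)).Dom := by
  rw [CountingSystem.Simulation.halts_iff]
  change (StateTransition.eval (T.step m) .start).Dom ↔ _
  rw [StateTransition.reaches_eval (f := T.step m) (b := .load 0 m) (.single rfl), eval_load,
    Nat.zero_add]
  -- The recorded last move does not influence the computation, so the machine is simulated step by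
  -- step.
  have hr : StateTransition.Respects (TM0.step T.machine) (T.step m)
      (fun c c' => ∃ d, c' = .run d c) := by
    rintro ⟨q, t⟩ _ ⟨d, rfl⟩
    rcases h : T.M q t.head with _ | ⟨q', e | b⟩
    · simp [TM0.step, h, step]
    · have h1 : TM0.step T.machine ⟨q, t⟩ = some ⟨q', t.move e⟩ := by simp [TM0.step, h]
      rw [h1]
      exact ⟨_, ⟨some e, rfl⟩, .single (by simp [step, h])⟩
    · have h1 : TM0.step T.machine ⟨q, t⟩ = some ⟨q', t.write b⟩ := by simp [TM0.step, h]
      rw [h1]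
      exact ⟨_, ⟨none, rfl⟩, .single (by simp [step, h])⟩
  exact StateTransition.tr_eval_dom hr ⟨none, rfl⟩

theorem finitelySatisfiable_iff (m : ℕ) :
    FinitelySatisfiable ((T.system m).runSentence T.base_pos) ↔
      (TM0.eval T.machine (T.tape m)).Dom :=
  ((T.simulation m).finitelySatisfiable_iff T.base_pos).trans (T.simulation_halts_iff m)

theorem satisfiable_iff (m : ℕ) :
    Satisfiable ((T.system m).infiniteRunSentence T.base_pos) ↔
      ¬ (TM0.eval T.machine (T.tape m)).Dom :=
  ((T.simulation m).satisfiable_iff T.base_pos).trans (not_congr (T.simulation_halts_iff m))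

open Formula in
theorem primrec_runSentence : Primrec fun m => (T.system m).runSentence T.base_pos := by
  let r (m : ℕ) (q : TMState T.Γ T.Λ) : Formula := stateRules T.base
    (fun b => (T.system m).mat b q) ((T.nextStates m q).map T.index) (T.index q)
  have key : Primrec fun m => (T.states m).map (r m) := by
    -- The matrices depend neither on `m` nor on the loading counter, so `m` enters only through
    -- state numbers and the length of the list. The loading states `j + 1` share the matrices of
    -- `load 1`.
    have hl : ∀ m, (T.states m).map (r m) = r m .start :: r 0 (.load 0) ::
        ((T.labels.map fun t => r 0 (.run t.1 t.2.1 t.2.2)) ++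
          (List.range m).map fun j => stateRules T.base
            (fun b => (T.system 0).mat b (.load 1)) [1 + T.num + j] (1 + T.num + (j + 1))) := by
      intro m
      simp only [states, List.map_cons, List.map_append, List.map_map]
      rfl
    simp only [hl]
    have hadd (k : ℕ) : Primrec fun m => k + m := Primrec.nat_add.comp (.const k) .id
    have hsingle : Primrec fun m => [1 + T.num + m] :=
      Primrec.list_cons.comp (hadd _) (.const [])
    have h1 : Primrec fun m => r m .start :=
      primrec_stateRules (fun b => (T.system 0).mat b .start) hsingle (.const 0)
    have h2 : Primrec fun m => (List.range m).map fun j => stateRules T.base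
        (fun b => (T.system 0).mat b (.load 1)) [1 + T.num + j] (1 + T.num + (j + 1)) :=
      Primrec.list_map Primrec.list_range
        (primrec_stateRules (fun b => (T.system 0).mat b (.load 1)) (hsingle.comp .snd)
          ((hadd (1 + T.num)).comp (Primrec.succ.comp .snd))).to₂
    exact Primrec.list_cons.comp h1 (Primrec.list_cons.comp (.const (r 0 (.load 0)))
      (Primrec.list_append.comp (.const (T.labels.map fun t => r 0 (.run t.1 t.2.1 t.2.2))) h2))
  exact primrec_and (.const (commonRules T.base)) (primrec_and
    (.const (startRules ((0, 0, ⟨0, T.base_pos⟩) : Color T.base) 0)) (primrec_conj.comp key))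

theorem primrec_infiniteRunSentence :
    Primrec fun m => (T.system m).infiniteRunSentence T.base_pos :=
  Formula.primrec_and T.primrec_runSentence
    (.const (avoidRules (T.finals.map T.index)))

/-- If the halting problem of the machine is undecidable, so are both satisfiability problems. -/
theorem not_decidableOnSentences
    (h : ¬ ComputablePred fun m => (TM0.eval T.machine (T.tape m)).Dom) :
    ¬ DecidableOnSentences Satisfiable ∧ ¬ DecidableOnSentences FinitelySatisfiable := by
  constructor
  · rintro ⟨f, hf, hf'⟩
    refine h (ComputablePred.computable_iff.2 ⟨fun m =>
      !(f ((T.system m).infiniteRunSentence T.base_pos)), ?_, ?_⟩)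
    · exact Primrec.not.to_comp.comp (hf.comp T.primrec_infiniteRunSentence.to_comp)
    · funext m
      have := (hf' _ ((T.system m).isSentence_infiniteRunSentence T.base_pos)).trans
        (T.satisfiable_iff m)
      rw [eq_iff_iff, Bool.not_eq_true', ← Bool.not_eq_true, this, not_not]
  · rintro ⟨f, hf, hf'⟩
    refine h (ComputablePred.computable_iff.2 ⟨fun m =>
      f ((T.system m).runSentence T.base_pos), ?_, ?_⟩)
    · exact hf.comp T.primrec_runSentence.to_comp
    · funext m
      exact propext ((hf' _ ((T.system m).isSentence_runSentence T.base_pos)).trans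
        (T.finitelySatisfiable_iff m)).symm

end FiniteTM
-- A Turing machine with undecidable halting problem on unary inputs.
open Turing

/-- The finite set `S` contains the initial state and is closed under transitions, so restricting
the machine to `S` changes no computation from the initial state. -/
theorem exists_finiteTM_of_supports {Γ Λ : Type} [Inhabited Γ] [Inhabited Λ] [Finite Γ]
    (M : TM0.Machine Γ Λ) (S : Finset Λ) (hS : TM0.Supports M (S : Set Λ)) (first fill : Γ) :
    ∃ T : FiniteTM, ∀ m, (TM0.eval T.machine (T.tape m)).Dom ↔
      (TM0.eval M (first :: List.replicate m fill)).Dom := by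
  classical
  have := Fintype.ofFinite Γ
  let instS : Inhabited S := ⟨⟨default, hS.1⟩⟩
  have : Finite Dir := ⟨⟨fun d => match d with | .left => (0 : Fin 2) | .right => 1,
    fun i => if i = 0 then .left else .right, by rintro ⟨⟩ <;> rfl, by decide⟩⟩
  have := Fintype.ofFinite (S × Γ × Option Dir)
  let e := Fintype.equivFin Γ
  let z : Fin (Fintype.card Γ) := ⟨0, Fintype.card_pos⟩
  -- The swap gives the blank the digit `0`, so that trailing blanks do not change the value of a
  -- half tape.
  let e' := e.trans (Equiv.swap (e default) z)
  let l := Fintype.equivFin (S × Γ × Option Dir)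
  let M' : S → Γ → Option (S × TM0.Stmt Γ) := fun q a =>
    (M q a).map fun p => (if h : p.1 ∈ S then ⟨p.1, h⟩ else default, p.2)
  let T : FiniteTM :=
    { Γ := Γ, Λ := S, instΓ := inferInstance, instΛ := inferInstance, M := M'
      base := Fintype.card Γ
      dg := fun a => (e' a).val
      dg_default := by simp [e', z]
      dg_injective := Fin.val_injective.comp e'.injective
      dg_lt := fun a => (e' a).isLt
      num := Fintype.card (S × Γ × Option Dir)
      label := fun t => (l t).val
      label_injective := Fin.val_injective.comp l.injective
      label_lt := fun t => (l t).isLt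
      symbols := Finset.univ.toList
      mem_symbols := by simp
      labels := Finset.univ.toList
      mem_labels := by simp
      first := first
      fill := fill }
  refine ⟨T, fun m => ?_⟩
  have hr : StateTransition.Respects (TM0.step M) (TM0.step T.machine)
      (fun c c' => c'.q.1 = c.q ∧ c'.Tape = c.Tape) := by
    rintro ⟨q, t⟩ ⟨⟨q₁, hq⟩, t₁⟩ ⟨hq₁, ht₁⟩
    obtain rfl : q = q₁ := hq₁.symm
    obtain rfl : t = t₁ := ht₁.symm
    rcases h : M q t.head with _ | ⟨q', s⟩
    · have h1 : M' ⟨q, hq⟩ t.head = none := by simp [M', h]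
      have h2 : TM0.step M ⟨q, t⟩ = none := by simp [TM0.step, h]
      rw [h2]
      change Option.map _ (M' ⟨q, hq⟩ t.head) = none
      rw [h1]; rfl
    · have hq' : q' ∈ S := hS.2 (show (q', s) ∈ M q t.head from h) hq
      have h1 : M' ⟨q, hq⟩ t.head = some (⟨q', hq'⟩, s) := by simp [M', h, hq']
      have h2 : ∃ t', TM0.step M ⟨q, t⟩ = some ⟨q', t'⟩ ∧
          TM0.step T.machine ⟨⟨q, hq⟩, t⟩ = some ⟨⟨q', hq'⟩, t'⟩ := by
        refine ⟨_, by simp only [TM0.step, h, Option.map_some]; rfl, ?_⟩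
        change Option.map _ (M' ⟨q, hq⟩ t.head) = some _
        rw [h1]; rfl
      obtain ⟨t', h2, h3⟩ := h2
      rw [h2]
      exact ⟨⟨⟨q', hq'⟩, t'⟩, ⟨rfl, rfl⟩, .single h3⟩
  exact StateTransition.tr_eval_dom hr (a₁ := TM0.init (first :: List.replicate m fill))
    (a₂ := TM0.init (T.tape m)) ⟨rfl, rfl⟩

/-- The number with `m` binary digits `1`. -/
def binaryOnes : ℕ → ℕ
  | 0 => 0
  | m + 1 => 2 * binaryOnes m + 1

theorem binaryOnes_injective : Function.Injective binaryOnes :=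
  (strictMono_nat_of_lt_succ fun m => by simp only [binaryOnes]; omega).injective

theorem primrec_binaryOnes : Primrec binaryOnes := by
  have h : Primrec fun m : ℕ => (Nat.rec 0 (fun _ y => 2 * y + 1) m : ℕ) :=
    Primrec.nat_rec₁ 0 (Primrec.succ.comp
      (Primrec.nat_mul.comp (Primrec.const 2) Primrec.snd)).to₂
  refine h.of_eq fun m => ?_
  induction m with
  | zero => rfl
  | succ m ih => simp only [binaryOnes, ← ih]

open PartrecToTM2 in
theorem trNat_binaryOnes (m : ℕ) : trNat (binaryOnes m) = List.replicate m Γ'.bit1 := by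
  have h1 : ∀ x : Num, trNum x.bit1 = Γ'.bit1 :: trNum x := by
    intro x
    cases x <;> rfl
  induction m with
  | zero => exact trNat_zero
  | succ m ih =>
    have h2 : ((binaryOnes (m + 1) : ℕ) : Num) = (binaryOnes m : Num).bit1 := by
      rw [← Num.bit1_of_bit1, binaryOnes]
      push_cast
      rw [two_mul]
    rw [trNat, h2, h1, List.replicate_succ, ← ih, trNat]

/-- A program whose halting problem on the inputs `binaryOnes m` is undecidable. -/
theorem exists_toPartrec_code : ∃ c : ToPartrec.Code,
    ¬ ComputablePred fun m => (c.eval [binaryOnes m]).Dom := by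
  let h : ℕ →. ℕ := fun m => (Denumerable.ofNat Nat.Partrec.Code m).eval 0
  have hh : Partrec h :=
    Nat.Partrec.Code.eval_part.comp (Computable.ofNat _) (Computable.const 0)
  -- The search decodes `m` from `binaryOnes m`, then program `m` runs on `0`. Inputs of this form
  -- have tapes of one repeated symbol, which the loading phase can write.
  let g : ℕ →. ℕ := fun n =>
    (Nat.rfind fun m => Part.some (decide (binaryOnes m = n))).bind h
  have hg : Partrec g := by
    refine (Partrec.rfind ?_).bind (hh.comp Computable.snd)
    have hd : Primrec fun p : ℕ × ℕ => decide (binaryOnes p.2 = p.1) :=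
      Primrec.eq.decide.comp (primrec_binaryOnes.comp .snd) .fst
    exact hd.to_comp.partrec
  have hgh (m : ℕ) : g (binaryOnes m) = h m := by
    have : (Nat.rfind fun k => Part.some (decide (binaryOnes k = binaryOnes m))) = Part.some m := by
      refine Part.eq_some_iff.2 (Nat.mem_rfind.2 ⟨by simp, fun {k} hk => ?_⟩)
      simpa using fun e => hk.ne (binaryOnes_injective e)
    simp only [g, this]
    exact Part.bind_some m h
  obtain ⟨c, hc⟩ := ToPartrec.Code.exists_code (Nat.Partrec'.part_iff₁.2 hg)
  refine ⟨c, fun hcomp => ComputablePred.halting_problem 0 ?_⟩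
  have heq : ∀ d : Nat.Partrec.Code, (d.eval 0).Dom ↔
      (c.eval [binaryOnes (Encodable.encode d)]).Dom := by
    intro d
    have := hc ⟨[binaryOnes (Encodable.encode d)], rfl⟩
    change c.eval [binaryOnes (Encodable.encode d)] = _ at this
    rw [this]
    change _ ↔ (g (binaryOnes (Encodable.encode d))).Dom
    rw [hgh]
    simp [h]
  obtain ⟨f, hf, hf'⟩ := ComputablePred.computable_iff.1 hcomp
  refine ComputablePred.computable_iff.2
    ⟨fun d => f (Encodable.encode d), hf.comp Computable.encode, ?_⟩
  funext d
  rw [heq d]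
  exact congrFun hf' (Encodable.encode d)

open PartrecToTM2 in
/-- There is a Turing machine whose halting problem on the inputs `tape m` is undecidable. -/
theorem exists_finiteTM_undecidable : ∃ T : FiniteTM,
    ¬ ComputablePred fun m => (TM0.eval T.machine (T.tape m)).Dom := by
  obtain ⟨c, hc⟩ := exists_toPartrec_code
  let inst : Inhabited Λ' := ⟨trNormal c .halt⟩
  have hK : Finite K' := by
    refine Finite.of_injective (fun k : K' => match k with
      | .main => (0 : Fin 4) | .rev => 1 | .aux => 2 | .stack => 3) ?_
    rintro ⟨⟩ ⟨⟩ h <;> first | rfl | cases h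
  have hΓ : Finite (TM2to1.Γ' K' fun _ => Γ') :=
    inferInstanceAs (Finite (Bool × (K' → Option Γ')))
  let top (a : Γ') : K' → Option Γ' := Function.update (fun _ => none) K'.main (some a)
  -- The stack is stored bottom first. Its bottom cell carries the flag `true` and the list
  -- separator; above it lie the `m` digits `1`.
  let a : TM2to1.Γ' K' fun _ => Γ' := (true, top .cons)
  let b : TM2to1.Γ' K' fun _ => Γ' := (false, top .bit1)
  obtain ⟨T, hT⟩ := exists_finiteTM_of_supports _ _
    (TM1to0.tr_supports _ (TM2to1.tr_supports tr (tr_supports c .halt))) a b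
  refine ⟨T, fun h => hc (h.of_eq fun m => ?_)⟩
  have h1 : (trList [binaryOnes m]).reverse = Γ'.cons :: List.replicate m Γ'.bit1 := by
    simp [trList, trNat_binaryOnes]
  have h2 : TM2to1.trInit (Γ := fun _ => Γ') K'.main (trList [binaryOnes m]) =
      a :: List.replicate m b := by
    rw [TM2to1.trInit, h1]
    exact congrArg (List.cons _) List.map_replicate
  have h3 : (TM2.init K'.main (trList [binaryOnes m]) : Cfg') = init c [binaryOnes m] := by
    simp only [TM2.init, init]
    congr 1
    funext k
    cases k <;> rfl
  rw [hT, ← h2]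
  refine (iff_of_eq (congrArg Part.Dom (TM1to0.tr_eval _ _))).trans
    ((TM2to1.tr_eval_dom tr K'.main _).trans ?_)
  change (StateTransition.eval (TM2.step tr) (TM2.init K'.main (trList [binaryOnes m]))).Dom ↔ _
  rw [h3, tr_eval]
  rfl

end NestedEqFO2

theorem theorem5 :
    ¬ NestedEqFO2.DecidableOnSentences NestedEqFO2.Satisfiable ∧
    ¬ NestedEqFO2.DecidableOnSentences NestedEqFO2.FinitelySatisfiable := by
  obtain ⟨T, hT⟩ := NestedEqFO2.exists_finiteTM_undecidable
  exact T.not_decidableOnSentences hT
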